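/- **Setting.** Let $\mathfrak H=\mathbb Q\langle x,y\rangle$, $\mathfrak H^1=\mathbb Q+y\mathfrak H$ and $z_k=yx^{k-1}$ ($k\ge1$), so that the words $z_{\boldsymbol k}=z_{k_1}\cdots z_{k_r}$, for $r\ge 0$ and $\boldsymbol k=(k_1,\dots,k_r)\in\mathbb Z_{\ge1}^r$, form a basis of $\mathfrak H^1$. Let $\mathbin{\sqcup\!\sqcup}$ be the shuffle product on $\mathfrak H$, that is, the $\mathbb Q$-bilinear product with unit $1$ and $(au)\mathbin{\sqcup\!\sqcup}(bv)=(a\mathbin{\sqcup\!\sqcup}bv)u+(au\mathbin{\sqcup\!\sqcup}b)v$ for $a,b\in\mathfrak H$ and letters $u,v\in\{x,y\}$. Put $\binom{-1}{0}=1$ and $\binom{l-1}{l}=0$ for $l\ge1$. The $t$-adic symmetrization map $\widehat\phi\colon\mathfrak H^1[[t]]\to\mathfrak H^1[[t]]$ is the $\mathbb Q[[t]]$-linear map with $$\widehat\phi(z_{\boldsymbol k})=\sum_{i=0}^r(-1)^{k_{i+1}+\cdots+k_r}\,z_{k_1}\cdots z_{k_i}\;\mathbin{\sqcup\!\sqcup}\sum_{l_{i+1},\dots,l_r\ge0}\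 \prod_{j=i+1}^r\binom{k_j+l_j-1}{l_j}\;z_{k_r+l_r}\cdots z_{k_{i+1}+l_{i+1}}\,t^{\,l_{i+1}+\cdots+l_r},$$ and $\phi\colon\mathfrak H^1\to\mathfrak H^1$ is its value at $t=0$, that is, $\phi(a)$ is the constant term of $\widehat\phi(a)$ for $a\in\mathfrak H^1$. A 2-colored rooted tree $X=(V,E,\mathrm{rt},V_\bullet)$ is a finite tree $(V,E)$ with a root $\mathrm{rt}\in V$ and a set $V_\bullet\subset V$ of black vertices that contains all vertices of degree $1$; the other vertices are white. Let $P(v,v')$ be the set of edges of the path from $v$ to $v'$. An index on $X$ is a tuple $\boldsymbol k=(k_e)_{e\in E}$ of non-negative integers; put $k_{E'}=\sum_{e\in E'}k_e$ for $E'\subset E$. It is essentially positive if $k_{P(v,v')}>0$ for all distinct $v,v'\in V_\bullet$. **Harvestable form.** Let $\mathrm{rt}\in V_\bullet$ and let $\boldsymbol k$ be essentially positive. The harvestable form $(X_{\rm h},\boldsymbol k_{\rm h})$ of $(X,\boldsymbol k)$ is obtained by the following four steps, each repeated as long as it applies. (i) Contract an edge of index $0$ that has a white end; the merged vertex has the color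 of the other end. (ii) If a white vertex has degree $2$, remove it and join its two edges into one, adding their indices. (iii) If a black vertex $v\ne\mathrm{rt}$ has degree at least $3$, insert a new white vertex $v'$ and an edge $\{v,v'\}$ of index $0$, and replace the edges $\{v,u\}$ by $\{v',u\}$, with the same index, for all children $u$ of $v$. (iv) If the root has degree at least $2$, do the same at the root. The result is independent of the choices made, up to isomorphism. For a harvestable form $(X,\boldsymbol k)$ the element $w(X,\boldsymbol k)\in\mathfrak H^1$ is defined recursively. If $X$ is a linear tree with vertices $v_1,\dots,v_{r+1}=\mathrm{rt}$ in this order ($r\ge0$), all black, then $w(X,\boldsymbol k)=z_{k_1}\cdots z_{k_r}$, where $k_a$ is the index on $\{v_a,v_{a+1}\}$. Otherwise, the path from the root up to the first white vertex $v_0$ has vertices $v_0,v_1,\dots,v_{r+1}=\mathrm{rt}$ ($r\ge0$), with index $k'$ on $\{v_0,v_1\}$ and $k_a$ on $\{v_a,v_{a+1}\}$; if $w_1,\dots,w_s$ are the elements of the pairs formed by the branches at $v_0$ leading away from the root, each with $v_0$ replaced by a black root, then $w(X,\boldsymbol k)=(w_1\,\mathbin{\sqcup\!\sqcup}\cdots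 \mathbin{\sqcup\!\sqcup}\,w_s)\,x^{k'}z_{k_1}\cdots z_{k_r}$. **Theorem.** Let $X=(V,E,\mathrm{rt},V_\bullet)$ be a 2-colored rooted tree with $\mathrm{rt}\in V_\bullet$, and let $\boldsymbol k$ be an essentially positive index on $X$. For $v\in V_\bullet$ put $X_v=(V,E,v,V_\bullet)$. Then, in $\mathfrak H^1[[t]]$, $$\widehat\phi\bigl(w(X_{\rm h},\boldsymbol k_{\rm h})\bigr)=\sum_{v\in V_\bullet}(-1)^{k_{P(\mathrm{rt},v)}}\sum_{\boldsymbol l\in\mathbb Z_{\ge0}^{P(\mathrm{rt},v)}}\ \prod_{e\in P(\mathrm{rt},v)}\binom{k_e+l_e-1}{l_e}\;w\bigl(X_{v,{\rm h}},(\boldsymbol k+\boldsymbol l)_{\rm h}\bigr)\,t^{\,l_{P(\mathrm{rt},v)}},$$ where $\boldsymbol l$ is extended by $0$ to the edges outside $P(\mathrm{rt},v)$. In particular, $$\phi\bigl(w(X_{\rm h},\boldsymbol k_{\rm h})\bigr)=\sum_{v\in V_\bullet}(-1)^{k_{P(\mathrm{rt},v)}}\,w(X_{v,{\rm h}},\boldsymbol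 k_{\rm h}).$$ -/

import Mathlib

open Finset

universe u

noncomputable section

namespace TwoCRT

/-! ### 2-colored rooted trees with an index -/

/-- The data `(X, k)` of a graph `X = (V, E, rt, V_•)` on a finite vertex set, with a root and a set
of black vertices, and of an index `k` on it. Only the values of `k` on edges are ever used.
That `X` is a 2-colored rooted tree is the predicate `IsTwoColoredRootedTree`. -/
structure Pair : Type (u + 1) where
  V : Type u
  [fin : Fintype V]
  G : SimpleGraph V
  rt : V
  black : Finset V
  k : Sym2 V → ℕ

attribute [instance] Pair.fin

namespace Pair

/-- The degree of a vertex. -/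
def deg (P : Pair.{u}) (v : P.V) : ℕ := (P.G.neighborSet v).ncard

open Classical in
/-- `P(v, w)`: the set of edges of the path from `v` to `w`. -/
def path (P : Pair.{u}) (v w : P.V) : Finset (Sym2 P.V) :=
  univ.filter fun e => ∃ p : P.G.Walk v w, p.IsPath ∧ e ∈ p.edges

/-- `p` is the parent of `v`. -/
def IsParent (P : Pair.{u}) (p v : P.V) : Prop := s(v, p) ∈ P.path P.rt v

/-- `(V, E, rt, V_•)` is a 2-colored rooted tree: `(V, E)` is a tree (finite by construction) all of
whose terminals (vertices of degree one) are black. -/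
structure IsTwoColoredRootedTree (P : Pair.{u}) : Prop where
  isTree : P.G.IsTree
  terminal_mem : ∀ v, P.deg v = 1 → v ∈ P.black

/-- `k` is essentially positive: `k_{P(v, w)} > 0` for distinct black `v`, `w`. -/
def EssentiallyPositive (P : Pair.{u}) : Prop :=
  ∀ v ∈ P.black, ∀ w ∈ P.black, v ≠ w → 0 < ∑ e ∈ P.path v w, P.k e

/-- The generators of the space `2CRT`: a 2-colored rooted tree with black root, together with an
essentially positive index. -/
structure IsTwoCRT (P : Pair.{u}) : Prop where
  tree : P.IsTwoColoredRootedTree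
  root_mem : P.rt ∈ P.black
  essPos : P.EssentiallyPositive

/-- `(X_v, k + l)`: the same tree with root `v`, and the index increased by `l`. -/
def reroot (P : Pair.{u}) (v : P.V) (l : Sym2 P.V → ℕ) : Pair.{u} where
  V := P.V
  G := P.G
  rt := v
  black := P.black
  k := P.k + l

/-! ### The harvestable form -/

open Classical in
/-- Contraction of the edge `{a, b}`, where `a` is white: the vertex `a` is merged into `b`, which
keeps its color; an edge `{a, y}` with `y ≠ b` becomes `{b, y}` with the same index. -/
def contract (P : Pair.{u}) (a b : P.V) (ha : P.rt ≠ a) : Pair.{u} where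
  V := {x : P.V // x ≠ a}
  G :=
    { Adj := fun x y => x ≠ y ∧
        (P.G.Adj x y ∨ (x.1 = b ∧ P.G.Adj a y) ∨ (y.1 = b ∧ P.G.Adj a x))
      symm := ⟨fun _ _ h => ⟨h.1.symm, h.2.imp (fun h => h.symm) Or.symm⟩⟩
      loopless := ⟨fun _ h => h.1 rfl⟩ }
  rt := ⟨P.rt, ha⟩
  black := univ.filter fun x => x.1 ∈ P.black
  k := fun e =>
    if e.map Subtype.val ∈ P.G.edgeSet then P.k (e.map Subtype.val)
    else P.k (e.map fun x => if x.1 = b then a else x.1)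

open Classical in
/-- Joining the edges `{a, b}` and `{b, c}`, where `b` is white of degree two: the vertex `b` is
removed and the two edges become one edge `{a, c}`, whose index is the sum of theirs. -/
def join (P : Pair.{u}) (a b c : P.V) (hb : P.rt ≠ b) : Pair.{u} where
  V := {x : P.V // x ≠ b}
  G :=
    { Adj := fun x y => x ≠ y ∧ (P.G.Adj x y ∨ s(x.1, y.1) = s(a, c))
      symm := ⟨fun _ _ h => ⟨h.1.symm, h.2.imp (fun h => h.symm) fun h => Sym2.eq_swap.trans h⟩⟩
      loopless := ⟨fun _ h => h.1 rfl⟩ }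
  rt := ⟨P.rt, hb⟩
  black := univ.filter fun x => x.1 ∈ P.black
  k := fun e =>
    if e.map Subtype.val = s(a, c) then P.k s(a, b) + P.k s(b, c) else P.k (e.map Subtype.val)

open Classical in
/-- Insertion of a new white vertex `none` at the location of `v`, with a new edge `{v, none}` of
index zero; the edges `{v, y}` to the children `y` of `v` become `{none, y}`, with the same index. -/
def insertAt (P : Pair.{u}) (v : P.V) : Pair.{u} where
  V := Option P.V
  G := SimpleGraph.fromRel fun x y =>
    match x, y with
    | some x, some y => P.G.Adj x y ∧ ¬ (x = v ∧ P.IsParent v y) ∧ ¬ (y = v ∧ P.IsParent v x)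
    | none, some y => y = v ∨ P.IsParent v y
    | _, none => False
  rt := some P.rt
  black := P.black.map Function.Embedding.some
  k := fun e => if e = s(none, some v) then 0 else P.k (e.map fun x => x.getD v)

/-- Contraction of an edge of index zero that has a white end `a`. -/
def Contracts (P Q : Pair.{u}) : Prop :=
  ∃ (a b : P.V) (ha : P.rt ≠ a), a ∉ P.black ∧ P.G.Adj a b ∧ P.k s(a, b) = 0 ∧
    Q = P.contract a b ha

/-- Joining the two edges at a white vertex `b` of degree two. -/
def Joins (P Q : Pair.{u}) : Prop :=
  ∃ (a b c : P.V) (hb : P.rt ≠ b), b ∉ P.black ∧ P.deg b = 2 ∧ P.G.Adj a b ∧ P.G.Adj b c ∧ a ≠ c ∧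
    Q = P.join a b c hb

/-- Insertion of a white vertex at a black branched point (degree at least three) that is not the
root. -/
def InsertsAtBranch (P Q : Pair.{u}) : Prop :=
  ∃ v : P.V, v ∈ P.black ∧ v ≠ P.rt ∧ 3 ≤ P.deg v ∧ Q = P.insertAt v

/-- Insertion of a white vertex at a root of degree at least two. -/
def InsertsAtRoot (P Q : Pair.{u}) : Prop :=
  2 ≤ P.deg P.rt ∧ Q = P.insertAt P.rt

/-- `Q` arises from `P` by repeating the step `R` until it cannot be applied any more. -/
def Exhausts (R : Pair.{u} → Pair.{u} → Prop) (P Q : Pair.{u}) : Prop :=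
  Relation.ReflTransGen R P Q ∧ ∀ Q' : Pair.{u}, ¬ R Q Q'

/-- `Q` is a harvestable form `(X_h, k_h)` of `P = (X, k)`: the outcome of some run of the
harvesting procedure. -/
def IsHarvestableForm (P Q : Pair.{u}) : Prop :=
  ∃ P₁ P₂ P₃ : Pair.{u}, Exhausts Contracts P P₁ ∧ Exhausts Joins P₁ P₂ ∧
    Exhausts InsertsAtBranch P₂ P₃ ∧ Exhausts InsertsAtRoot P₃ Q

end Pair

/-! ### The algebra `ℌ = ℚ⟨x, y⟩` -/

/-- `ℌ = ℚ⟨x, y⟩`, where the letter `x` is `0 : Fin 2` and the letter `y` is `1 : Fin 2`. -/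
abbrev HAlg : Type := FreeAlgebra ℚ (Fin 2)

/-- The generator `x`. -/
def genX : HAlg := FreeAlgebra.ι ℚ 0

/-- The generator `y`. -/
def genY : HAlg := FreeAlgebra.ι ℚ 1

/-- `ℌ¹ = ℚ + yℌ`. -/
def HOne : Submodule ℚ HAlg := Submodule.span ℚ {1} ⊔ LinearMap.range (LinearMap.mulLeft ℚ genY)

/-- `z_k = y x^{k-1}` for `k ≥ 1`. -/
def zGen (k : ℕ) : HAlg := genY * genX ^ (k - 1)

/-- `z_{k_1} ⋯ z_{k_r}`. -/
def zIndex (k : List ℕ) : HAlg := (k.map zGen).prod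

/-- The word (a basis element of `ℌ`) `z_{k_1} ⋯ z_{k_r}` of an index `(k_1, …, k_r)`. -/
def zWord (k : List ℕ+) : FreeMonoid (Fin 2) :=
  (k.map fun j => FreeMonoid.of 1 * FreeMonoid.of 0 ^ ((j : ℕ) - 1)).prod

/-- The shuffle of two words, both read from the last letter to the first. -/
def shuffleRev : List (Fin 2) → List (Fin 2) → HAlg
  | [], v => (v.reverse.map (FreeAlgebra.ι ℚ)).prod
  | a :: u, [] => ((a :: u).reverse.map (FreeAlgebra.ι ℚ)).prod
  | a :: u, b :: v =>
    shuffleRev u (b :: v) * FreeAlgebra.ι ℚ a + shuffleRev (a :: u) v * FreeAlgebra.ι ℚ b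
termination_by u v => u.length + v.length

/-- The shuffle product on `ℌ`: the bilinear map given on words by `a ш 1 = 1 ш a = a` and
`(a₁ u₁) ш (a₂ u₂) = (a₁ ш a₂ u₂) u₁ + (a₁ u₁ ш a₂) u₂`, where `u₁`, `u₂` are letters. -/
def shuffle : HAlg →ₗ[ℚ] HAlg →ₗ[ℚ] HAlg :=
  (FreeAlgebra.basisFreeMonoid ℚ (Fin 2)).constr ℚ fun u =>
    (FreeAlgebra.basisFreeMonoid ℚ (Fin 2)).constr ℚ fun v =>
      shuffleRev u.toList.reverse v.toList.reverse

/-- The shuffle product of finitely many elements. -/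
def shuffleList (L : List HAlg) : HAlg := L.foldr (fun a b => shuffle a b) 1

/-! ### The symmetrization maps -/

/-- The coefficient of `t^n` in `∑_l b(k, l) z_{reverse (k + l)} t^{wt l}`. Note that
`(0 + l - 1).choose l` is `1` for `l = 0` and `0` for `l > 0`. -/
def revSeriesCoeff (k : List ℕ) (n : ℕ) : HAlg :=
  ∑ l ∈ piAntidiag (univ : Finset (Fin k.length)) n,
    ((∏ i, (k.get i + l i - 1).choose (l i) : ℕ) : ℚ) •
      zIndex (List.ofFn fun i => k.get i + l i).reverse

/-- `φ̂(z_k)` for an index `k = (k_1, …, k_r)`. -/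
def phiHatIndex (k : List ℕ) : PowerSeries HAlg :=
  PowerSeries.mk fun n => ∑ i ∈ range (k.length + 1),
    (-1 : ℚ) ^ (k.drop i).sum • shuffle (zIndex (k.take i)) (revSeriesCoeff (k.drop i) n)

/-- The restriction of `φ̂` to `ℌ¹`, as the linear map with the given values on the basis `z_k`
of `ℌ¹`. It is extended by zero to the words that do not lie in `ℌ¹`. -/
def phiHatOnH1 : HAlg →ₗ[ℚ] PowerSeries HAlg :=
  (FreeAlgebra.basisFreeMonoid ℚ (Fin 2)).constr ℚ
    (Function.extend zWord (fun k => phiHatIndex (k.map fun j => (j : ℕ))) 0)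

/-- The `t`-adic symmetrization map `φ̂`, the `ℚ⟦t⟧`-linear extension of `phiHatOnH1`. It is
meant for series with coefficients in `ℌ¹`. -/
def phiHat (f : PowerSeries HAlg) : PowerSeries HAlg :=
  PowerSeries.mk fun n => ∑ p ∈ antidiagonal n,
    PowerSeries.coeff p.2 (phiHatOnH1 (PowerSeries.coeff p.1 f))

/-- The symmetrization map `φ` on `ℌ¹`: the value of `φ̂` at `t = 0`. -/
def phi (a : HAlg) : HAlg := PowerSeries.constantCoeff (phiHat (PowerSeries.C a))

/-! ### The element `w(X, k)` -/

namespace Pair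

open Classical in
/-- The children of a vertex. -/
def children (P : Pair.{u}) (v : P.V) : Finset P.V := univ.filter fun c => P.IsParent v c

open Classical in
/-- The element `w` of the part of the tree that lies above `v`, with `v` taken as a black root: the
shuffle product of the elements of its branches. The branch through a child `c` contributes
`w_c z_k` if `c` is black and `w_c x^k` if `c` is white, where `k` is the index on `{v, c}` and `w_c`
the element of the part above `c`. The first argument bounds the number of levels that are read. -/
def wAbove (P : Pair.{u}) : ℕ → P.V → HAlg
  | 0, _ => 1
  | n + 1, v => shuffleList ((P.children v).toList.map fun c =>
      P.wAbove n c * if c ∈ P.black then zGen (P.k s(v, c)) else genX ^ P.k s(v, c))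

/-- The element `w(X, k) ∈ ℌ¹`, for a harvestable pair `(X, k)`. Unfolding the recursion along the
black vertices next to the root gives `z_{k_1} ⋯ z_{k_r}` for a linear tree of black vertices, and
`(w_1 ш ⋯ ш w_s) x^{k'} z_{k_1} ⋯ z_{k_r}` if they end in a white vertex with `s` branches, where
`w_j` is the element of the `j`-th branch planted on a black root. -/
def w (P : Pair.{u}) : HAlg := P.wAbove (Fintype.card P.V) P.rt

/-- The coefficient of `t^n` in
`∑_{l ∈ ℤ_{≥0}^{P(rt, v)}} b_{P(rt, v)}(k, l) w(X_{v,h}, (k + l)_h) t^{l_{P(rt, v)}}`,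
where `h` is a choice of harvestable forms. -/
def termCoeff (P : Pair.{u}) (h : Pair.{u} → Pair.{u}) (v : P.V) (n : ℕ) : HAlg :=
  letI : DecidableEq (Sym2 P.V) := Classical.decEq _
  ∑ l ∈ piAntidiag (P.path P.rt v) n,
    ((∏ e ∈ P.path P.rt v, (P.k e + l e - 1).choose (l e) : ℕ) : ℚ) • (h (P.reroot v l)).w

end Pair

end TwoCRT

end

open TwoCRT

noncomputable section

namespace TwoCRT

/-! Write `a ш b` for the shuffle product. On `ℌ¹` one has `φ̂(a) = a + D(a; y, 1)`, where `D(a; d,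
g)` is `deconc a d g` (`phiHatOnH1_eq`). The operator `D` strips the letters of `a` from the end and
appends letters to the series `g`, each followed by `(1 - x t)⁻¹`, with one sign `-1` per stripped
letter. A stripped letter first waits in `d` for one step. Thus `z_k = y x^{k-1}`, stripped from its
end while a `y` is waiting, is laid down as `y x^{k-1}` and leaves a `y` waiting again. Whenever the
stripped letter is `y`, the remaining prefix shuffled with the current series is added to the
result. The powers of `(1 - x t)⁻¹` expand into the binomial coefficients.

The decisive fact is that `D` is a derivation: `D(a ш b; d, g) = D(a; d, b ш g) + D(b; d, a ш g)`
(`deconc_shuffle`). It rests on the compatibility of the shuffle recursion with the factors `(1 - x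
t)⁻¹` (`act_mul_geomX`).

For a vertex `v` let `F v` be the element of the part of the tree above `v`, and let `f v` be the
generating series, over the increments `l`, of the part beyond the edge from `v` to its parent. By
the derivation rule `D(F v; color of v, f v)` is the sum over the children `c` of `(-1)^k (D(F c;
color of c, f c) + F c ш f c)`, where `k` is the index of the edge and the last term occurs only for
`c` black and `k > 0` (`deconc_eq_sum_kids`). The delay of one letter is what rerooting asks for: a
reversed edge takes the color of its other end. Summed over all `v` with signs, the `D`-terms
telescope to the one at the root (`deconc_root`). Moving the root step by step shows that `F v ш f
v` is the series belonging to a black vertex `v` (`IsTwoCRT.mk_termCoeff`).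

The harvesting steps do not change the value of the tree, provided that a vertex counts as black
when its component in the graph of edges of index zero contains a black vertex
(`w_harvestableForm`). All elements `w` can therefore be computed on the original tree. Essential
positivity leaves at most one black vertex in a component, and the signed terms are constant on
components, so the terms of the telescoped sum correspond to black vertices. -/

/-! ### Words and the shuffle product -/

/-- The element of `ℌ` given by a word that is read from its last letter to its first. -/
def revWord (u : List (Fin 2)) : HAlg := (u.reverse.map (FreeAlgebra.ι ℚ)).prod

@[simp] lemma revWord_nil : revWord [] = 1 := by simp [revWord]

lemma revWord_cons (a : Fin 2) (u : List (Fin 2)) :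
    revWord (a :: u) = revWord u * FreeAlgebra.ι ℚ a := by
  simp [revWord]

lemma basisFreeMonoid_apply (w : FreeMonoid (Fin 2)) :
    FreeAlgebra.basisFreeMonoid ℚ (Fin 2) w = (w.toList.map (FreeAlgebra.ι ℚ)).prod := by
  simp [FreeAlgebra.basisFreeMonoid, FreeAlgebra.equivMonoidAlgebraFreeMonoid,
    FreeMonoid.lift_apply]

lemma basisFreeMonoid_ofList_reverse (u : List (Fin 2)) :
    FreeAlgebra.basisFreeMonoid ℚ (Fin 2) (FreeMonoid.ofList u.reverse) = revWord u := by
  rw [basisFreeMonoid_apply, revWord]; rfl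

/-- A linear map given by its values on reversed words. -/
lemma constr_revWord {M : Type*} [AddCommMonoid M] [Module ℚ M] (f : FreeMonoid (Fin 2) → M)
    (u : List (Fin 2)) :
    (FreeAlgebra.basisFreeMonoid ℚ (Fin 2)).constr ℚ f (revWord u) =
      f (FreeMonoid.ofList u.reverse) := by
  rw [← basisFreeMonoid_ofList_reverse, Module.Basis.constr_basis]

lemma span_revWord : Submodule.span ℚ (Set.range revWord) = ⊤ := by
  rw [← (FreeAlgebra.basisFreeMonoid ℚ (Fin 2)).span_eq]
  congr 1
  ext a
  constructor
  · rintro ⟨u, rfl⟩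
    exact ⟨_, basisFreeMonoid_ofList_reverse u⟩
  · rintro ⟨w, rfl⟩
    refine ⟨w.toList.reverse, ?_⟩
    rw [← basisFreeMonoid_ofList_reverse, List.reverse_reverse]; rfl

/-- Induction on the last letter. -/
lemma hAlg_induction {p : HAlg → Prop} (add : ∀ a b, p a → p b → p (a + b))
    (smul : ∀ (q : ℚ) a, p a → p (q • a)) (one : p 1)
    (mul : ∀ u c, p (revWord u) → p (revWord u * FreeAlgebra.ι ℚ c)) (a : HAlg) : p a := by
  have ha : a ∈ Submodule.span ℚ (Set.range revWord) := by rw [span_revWord]; trivial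
  induction ha using Submodule.span_induction with
  | mem x hx =>
    obtain ⟨u, rfl⟩ := hx
    induction u with
    | nil => simpa using one
    | cons c u ih => rw [revWord_cons]; exact mul u c ih
  | zero => simpa using smul 0 1 one
  | add x y _ _ hx hy => exact add x y hx hy
  | smul q x _ hx => exact smul q x hx

lemma shuffle_revWord (u v : List (Fin 2)) :
    shuffle (revWord u) (revWord v) = shuffleRev u v := by
  simp [shuffle, constr_revWord]

lemma shuffle_one (a : HAlg) : shuffle a 1 = a := by
  induction a using hAlg_induction with
  | add a b ha hb => simp [ha, hb]
  | smul q a ha => simp [ha]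
  | one => rw [← revWord_nil, shuffle_revWord]; simp [shuffleRev]
  | mul u c _ =>
    rw [← revWord_nil, ← revWord_cons, shuffle_revWord, shuffleRev]; rfl

lemma one_shuffle (a : HAlg) : shuffle 1 a = a := by
  induction a using hAlg_induction with
  | add a b ha hb => simp [ha, hb]
  | smul q a ha => simp [ha]
  | one => exact shuffle_one 1
  | mul u c _ =>
    rw [← revWord_nil, ← revWord_cons, shuffle_revWord, shuffleRev]; rfl

/-- Two linear maps that agree on words agree. -/
lemma ext_revWord {M : Type*} [AddCommMonoid M] [Module ℚ M] {f g : HAlg →ₗ[ℚ] M}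
    (h : ∀ u, f (revWord u) = g (revWord u)) : f = g :=
  LinearMap.ext_on_range span_revWord h

/-- Both sides are bilinear in `a` and `b`, so the recursion of `shuffleRev` on words extends to all
elements. -/
lemma shuffle_mul_mul (a b : HAlg) (c d : Fin 2) :
    shuffle (a * FreeAlgebra.ι ℚ c) (b * FreeAlgebra.ι ℚ d) =
      shuffle a (b * FreeAlgebra.ι ℚ d) * FreeAlgebra.ι ℚ c +
        shuffle (a * FreeAlgebra.ι ℚ c) b * FreeAlgebra.ι ℚ d := by
  let R (c : Fin 2) : HAlg →ₗ[ℚ] HAlg := LinearMap.mulRight ℚ (FreeAlgebra.ι ℚ c)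
  have h : (shuffle.comp (R c)).compl₂ (R d) =
      (shuffle.compl₂ (R d)).compr₂ (R c) + (shuffle.comp (R c)).compr₂ (R d) := by
    refine ext_revWord fun u => ext_revWord fun v => ?_
    simp only [R, LinearMap.compl₂_apply, LinearMap.comp_apply, LinearMap.mulRight_apply,
      LinearMap.add_apply, LinearMap.compr₂_apply]
    rw [← revWord_cons, ← revWord_cons, shuffle_revWord, shuffle_revWord, shuffle_revWord,
      shuffleRev]
  exact LinearMap.congr_fun (LinearMap.congr_fun h a) b

lemma shuffle_comm (a b : HAlg) : shuffle a b = shuffle b a := by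
  suffices h : shuffle = shuffle.flip by
    conv_lhs => rw [h]
    rfl
  refine ext_revWord fun u => ext_revWord fun v => ?_
  rw [LinearMap.flip_apply]
  induction u generalizing v with
  | nil => simp [shuffle_one, one_shuffle]
  | cons c u ihu =>
    induction v with
    | nil => simp [shuffle_one, one_shuffle]
    | cons d v ihv =>
      rw [revWord_cons, revWord_cons] at *
      rw [shuffle_mul_mul, shuffle_mul_mul, ihv, ← revWord_cons d, ihu, revWord_cons, add_comm]

/-- A property that is stable under linear combinations holds if it holds for words. -/
lemma revWord_induction {p : HAlg → Prop} (add : ∀ a b, p a → p b → p (a + b))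
    (smul : ∀ (q : ℚ) a, p a → p (q • a)) (word : ∀ u, p (revWord u)) (a : HAlg) : p a :=
  hAlg_induction add smul (by simpa using word []) (fun u c _ => by
    simpa [revWord_cons] using word (c :: u)) a

/-- A last letter of a triple shuffle comes from one of the three words; the terms are matched by
induction on the word that loses its letter. -/
lemma shuffle_assoc (a b c : HAlg) : shuffle (shuffle a b) c = shuffle a (shuffle b c) := by
  induction a using revWord_induction with
  | add a a' h h' => simp [h, h']
  | smul q a h => simp [h]
  | word u =>
  induction b using revWord_induction with
  | add a a' h h' => simp [h, h']
  | smul q a h => simp [h]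
  | word v =>
  induction c using revWord_induction with
  | add a a' h h' => simp [h, h']
  | smul q a h => simp [h]
  | word w =>
  induction u generalizing v w with
  | nil => simp [one_shuffle]
  | cons p u ihu =>
    induction v generalizing w with
    | nil => simp [one_shuffle, shuffle_one]
    | cons q v ihv =>
      induction w with
      | nil => simp [shuffle_one]
      | cons r w ihw =>
        have h1 := ihu (q :: v) (r :: w)
        have h2 := ihv (r :: w)
        simp only [revWord_cons] at h1 h2 ihw ⊢
        rw [shuffle_mul_mul, map_add, LinearMap.add_apply] at ihw ⊢
        rw [shuffle_mul_mul, shuffle_mul_mul, h1, h2, shuffle_mul_mul (revWord v), map_add,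
          map_add, shuffle_mul_mul (revWord u), shuffle_mul_mul (revWord u), ← ihw]
        simp only [add_mul]
        abel

/-! ### Formal power series over the shuffle algebra -/

/-- Shuffling all coefficients of a power series with a fixed element. -/
def act : HAlg →ₗ[ℚ] PowerSeries HAlg →ₗ[ℚ] PowerSeries HAlg :=
  LinearMap.mk₂ ℚ (fun a f => PowerSeries.mk fun n => shuffle a (PowerSeries.coeff n f))
    (fun a b f => by ext n; simp) (fun q a f => by ext n; simp)
    (fun a f g => by ext n; simp) (fun q a f => by ext n; simp)

@[simp] lemma coeff_act (a : HAlg) (f : PowerSeries HAlg) (n : ℕ) :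
    PowerSeries.coeff n (act a f) = shuffle a (PowerSeries.coeff n f) := by
  simp [act]

lemma act_one (f : PowerSeries HAlg) : act 1 f = f := by
  ext n; simp [one_shuffle]

lemma act_shuffle (a b : HAlg) (f : PowerSeries HAlg) : act (shuffle a b) f = act a (act b f) := by
  ext n; simp [shuffle_assoc]

lemma act_comm (a b : HAlg) (f : PowerSeries HAlg) : act a (act b f) = act b (act a f) := by
  rw [← act_shuffle, shuffle_comm, act_shuffle]

lemma act_C (a b : HAlg) : act a (PowerSeries.C b) = PowerSeries.C (shuffle a b) := by
  ext n
  simp only [coeff_act, PowerSeries.coeff_C]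
  split_ifs <;> simp

lemma act_mul_X (a : HAlg) (f : PowerSeries HAlg) :
    act a (f * PowerSeries.X) = act a f * PowerSeries.X := by
  ext n
  cases n <;> simp [PowerSeries.coeff_succ_mul_X]

/-- A letter as a constant power series. -/
def letter (c : Fin 2) : PowerSeries HAlg := PowerSeries.C (FreeAlgebra.ι ℚ c)

lemma act_mul_mul (a : HAlg) (f : PowerSeries HAlg) (c d : Fin 2) :
    act (a * FreeAlgebra.ι ℚ c) (f * letter d) =
      act a (f * letter d) * letter c + act (a * FreeAlgebra.ι ℚ c) f * letter d := by
  ext n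
  simp [letter, PowerSeries.coeff_mul_C, shuffle_mul_mul]

/-- The geometric series `∑ xⁿ tⁿ`. -/
def geomX : PowerSeries HAlg := PowerSeries.mk fun n => genX ^ n

lemma mul_X_comm (f : PowerSeries HAlg) : PowerSeries.X * f = f * PowerSeries.X :=
  (PowerSeries.commute_X f).symm.eq

lemma geomX_eq : geomX = 1 + geomX * letter 0 * PowerSeries.X := by
  ext n
  cases n with
  | zero => simp [geomX]
  | succ n =>
    rw [map_add, PowerSeries.coeff_succ_mul_X, letter, PowerSeries.coeff_mul_C]
    simp [geomX, genX, pow_succ, PowerSeries.coeff_one]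

lemma geomX_mul : (1 - letter 0 * PowerSeries.X) * geomX = 1 := by
  ext n
  rw [sub_mul, one_mul, mul_assoc, mul_X_comm, ← mul_assoc]
  cases n with
  | zero => simp [geomX]
  | succ n =>
    rw [map_sub, PowerSeries.coeff_succ_mul_X, letter, PowerSeries.coeff_C_mul]
    simp [geomX, genX, pow_succ', PowerSeries.coeff_one]

/-- A factor `(1 - x t)⁻¹` on the right may be moved to the other side. -/
lemma eq_mul_geomX {f g : PowerSeries HAlg} (h : f = g + f * letter 0 * PowerSeries.X) :
    f = g * geomX := by
  have h' : f * (1 - letter 0 * PowerSeries.X) = g := by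
    rw [mul_sub, mul_one, ← mul_assoc]
    exact sub_eq_of_eq_add h
  rw [← h', mul_assoc, geomX_mul, mul_one]

/-- With `f = g d (1 - x t)⁻¹ = g d + f x t`, the shuffle recursion gives `bc ш f = (bc ш g) d + (b
ш f) c + (bc ш f) x t`. Solving this for `bc ш f` puts the factor `(1 - x t)⁻¹` after both new
letters. -/
lemma act_mul_geomX (b : HAlg) (g : PowerSeries HAlg) (c d : Fin 2) :
    act (b * FreeAlgebra.ι ℚ c) (g * letter d * geomX) =
      act (b * FreeAlgebra.ι ℚ c) g * letter d * geomX +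
        act b (g * letter d * geomX) * letter c * geomX := by
  rw [← add_mul]
  apply eq_mul_geomX
  have h : g * letter d * geomX =
      g * letter d + g * letter d * geomX * letter 0 * PowerSeries.X := by
    conv_lhs => rw [geomX_eq, mul_add, mul_one, ← mul_assoc, ← mul_assoc]
  set f := g * letter d * geomX with hf
  conv_lhs => rw [h, map_add, act_mul_mul, act_mul_X, act_mul_mul, add_mul]
  have h2 : act b f = act b (g * letter d) + act b (f * letter 0) * PowerSeries.X := by
    conv_lhs => rw [h, map_add, act_mul_X]
  rw [h2, add_mul, mul_assoc (act b (f * letter 0)) PowerSeries.X, mul_X_comm (letter c),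
    ← mul_assoc]
  abel

/-! ### The operator behind the symmetrization map -/

/-- The operator `deconc` on words that are read from the last letter to the first. -/
def deconcAux : List (Fin 2) → Fin 2 → PowerSeries HAlg → PowerSeries HAlg
  | [], _, _ => 0
  | c :: u, d, g =>
    -((if c = 1 then act (revWord u) (g * letter d * geomX) else 0) +
      deconcAux u c (g * letter d * geomX))

/-- The linear map that sends a word `w` to the sum, over all its factorizations `w = w₁ y v`, of
`- w₁ ш (g d (S(v) ш (1 - x t)⁻¹))`, where `S` is the antipode of the shuffle algebra. -/
def deconc : HAlg →ₗ[ℚ] Fin 2 → PowerSeries HAlg → PowerSeries HAlg :=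
  (FreeAlgebra.basisFreeMonoid ℚ (Fin 2)).constr ℚ fun u => deconcAux u.toList.reverse

lemma deconc_revWord (u : List (Fin 2)) : deconc (revWord u) = deconcAux u := by
  simp [deconc, constr_revWord]

lemma deconc_one (d : Fin 2) (g : PowerSeries HAlg) : deconc 1 d g = 0 := by
  rw [← revWord_nil, deconc_revWord]; rfl

/-- The recursion extends from words to all elements by linearity. The waiting letter `d` is
appended to `g`, and the stripped letter `c` takes its place. -/
lemma deconc_mul (a : HAlg) (c d : Fin 2) (g : PowerSeries HAlg) :
    deconc (a * FreeAlgebra.ι ℚ c) d g =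
      -((if c = 1 then act a (g * letter d * geomX) else 0) +
        deconc a c (g * letter d * geomX)) := by
  induction a using revWord_induction with
  | add a b ha hb =>
    rw [add_mul, map_add, Pi.add_apply, Pi.add_apply, ha, hb]
    simp only [map_add, LinearMap.add_apply, Pi.add_apply]
    split_ifs <;> abel
  | smul q a ha =>
    rw [smul_mul_assoc, map_smul, Pi.smul_apply, Pi.smul_apply, ha]
    simp only [map_smul, LinearMap.smul_apply, Pi.smul_apply]
    split_ifs <;> simp [smul_add]
  | word u => rw [← revWord_cons, deconc_revWord, deconc_revWord]; rfl

lemma deconc_add (a : HAlg) (d : Fin 2) (g g' : PowerSeries HAlg) :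
    deconc a d (g + g') = deconc a d g + deconc a d g' := by
  induction a using hAlg_induction generalizing d g g' with
  | add a b ha hb => simp only [map_add, Pi.add_apply, ha, hb]; abel
  | smul q a ha => simp [ha]
  | one => simp [deconc_one]
  | mul u c ih =>
    simp only [deconc_mul, add_mul, ih, map_add]
    split_ifs <;> abel

/-- `deconc` is a derivation for the shuffle product. -/
lemma deconc_shuffle (a b : HAlg) (d : Fin 2) (g : PowerSeries HAlg) :
    deconc (shuffle a b) d g = deconc a d (act b g) + deconc b d (act a g) := by
  induction a using revWord_induction generalizing d g with
  | add a a' h h' => simp [h, h', deconc_add]; abel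
  | smul q a h =>
    have hz (c : HAlg) (f : PowerSeries HAlg) : deconc c d (q • f) = q • deconc c d f :=
      map_rat_smul (AddMonoidHom.mk' (deconc c d) (deconc_add c d)) q f
    simp [h, hz]
  | word u =>
  induction b using revWord_induction generalizing d g with
  | add a a' h h' => simp [h, h', deconc_add]; abel
  | smul q a h =>
    have hz (c : HAlg) (f : PowerSeries HAlg) : deconc c d (q • f) = q • deconc c d f :=
      map_rat_smul (AddMonoidHom.mk' (deconc c d) (deconc_add c d)) q f
    simp [h, hz]
  | word v =>
  induction u generalizing v d g with
  | nil => simp [one_shuffle, deconc_one, act_one]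
  | cons p u ihu =>
    induction v generalizing d g with
    | nil => simp [shuffle_one, deconc_one, act_one]
    | cons q v ihv =>
      have h1 := ihu (q :: v)
      simp only [revWord_cons] at h1 ihv ⊢
      generalize revWord u = a at *
      generalize revWord v = b at *
      rw [shuffle_mul_mul, map_add, Pi.add_apply, Pi.add_apply, deconc_mul, deconc_mul, h1, ihv]
      rw [deconc_mul a p d, deconc_mul b q d]
      set A := a * FreeAlgebra.ι ℚ p with hA
      set B := b * FreeAlgebra.ι ℚ q with hB
      set G := g * letter d * geomX with hG
      have eB : act B G = act B g * letter d * geomX + act b G * letter q * geomX := by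
        rw [hB, hG, act_mul_geomX]
      have eA : act A G = act A g * letter d * geomX + act a G * letter p * geomX := by
        rw [hA, hG, act_mul_geomX]
      rw [act_shuffle a B, act_shuffle A b, act_comm A b, eA, eB]
      simp only [deconc_add, map_add]
      -- The second summands of `eA` and `eB` have no counterpart on the right. They cancel against
      -- `deconc A q (act b G)` and `deconc B p (act a G)`, once these are expanded.
      have e1 := deconc_mul a p q (act b G)
      have e2 := deconc_mul b q p (act a G)
      rw [← hA] at e1
      rw [← hB] at e2
      rw [e1, e2]
      split_ifs <;> abel

/-! ### The series attached to an edge -/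

/-- The series `∑ binom(k + l - 1, l) c x^{k + l - 1} t^l` for a letter `c` (and `k ≥ 1`). -/
def edgeSeries (k : ℕ) (c : Fin 2) : PowerSeries HAlg :=
  PowerSeries.mk fun l => ((k + l - 1).choose l : ℚ) • (FreeAlgebra.ι ℚ c * genX ^ (k + l - 1))

lemma edgeSeries_one (c : Fin 2) : edgeSeries 1 c = letter c * geomX := by
  ext n
  simp [edgeSeries, letter, geomX, PowerSeries.coeff_C_mul]

/-- Pascal's rule is the equation `f = g + f x t`, whose solution is `f = g (1 - x t)⁻¹`. -/
lemma edgeSeries_succ_succ (k : ℕ) (c : Fin 2) :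
    edgeSeries (k + 2) c = edgeSeries (k + 1) c * letter 0 * geomX := by
  apply eq_mul_geomX
  ext n
  cases n with
  | zero => simp [edgeSeries, letter, genX, pow_succ, mul_assoc]
  | succ n =>
    rw [map_add, PowerSeries.coeff_succ_mul_X, letter, PowerSeries.coeff_mul_C,
      PowerSeries.coeff_mul_C]
    simp only [edgeSeries, PowerSeries.coeff_mk, smul_mul_assoc, mul_assoc]
    have e1 : k + 2 + (n + 1) - 1 = (k + n + 1) + 1 := by omega
    have e2 : k + 1 + (n + 1) - 1 = k + n + 1 := by omega
    have e3 : k + 2 + n - 1 = k + n + 1 := by omega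
    rw [e1, e2, e3, Nat.choose_succ_succ, ← genX, ← pow_succ, ← add_smul, Nat.cast_add, add_comm]

lemma edgeSeries_succ (k : ℕ) (c : Fin 2) :
    edgeSeries (k + 1) c = letter c * geomX * (letter 0 * geomX) ^ k := by
  induction k with
  | zero => simp [edgeSeries_one]
  | succ k ih => rw [edgeSeries_succ_succ, ih, pow_succ]; simp only [mul_assoc]

/-- Because of the delay, stripping `x^{k+1}` appends `d x^k` and leaves an `x` waiting. No stripped
letter is `y`, so nothing is shuffled yet. -/
lemma deconc_mul_genX_pow (a : HAlg) (k : ℕ) (d : Fin 2) (g : PowerSeries HAlg) :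
    deconc (a * genX ^ (k + 1)) d g =
      (-1 : ℚ) ^ (k + 1) • deconc a 0 (g * edgeSeries (k + 1) d) := by
  induction k generalizing d g with
  | zero => simp [genX, deconc_mul, edgeSeries_one, mul_assoc]
  | succ k ih =>
    have e : a * genX ^ (k + 1 + 1) = a * genX ^ (k + 1) * FreeAlgebra.ι ℚ 0 := by
      rw [pow_succ, ← mul_assoc]; rfl
    rw [e, deconc_mul, if_neg (by decide), zero_add, ih, edgeSeries_succ, edgeSeries_succ,
      pow_succ _ (k + 1), pow_succ' (letter 0 * geomX)]
    simp only [mul_assoc, mul_neg, neg_smul, mul_one]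

lemma zGen_succ (k : ℕ) : zGen (k + 1) = FreeAlgebra.ι ℚ 1 * genX ^ k := rfl

/-- The final `y` of the block releases the shuffle with the prefix `a` and then becomes the waiting
letter. -/
lemma deconc_mul_zGen (a : HAlg) {k : ℕ} (hk : 0 < k) (d : Fin 2) (g : PowerSeries HAlg) :
    deconc (a * zGen k) d g =
      (-1 : ℚ) ^ k • (act a (g * edgeSeries k d) + deconc a 1 (g * edgeSeries k d)) := by
  obtain ⟨k, rfl⟩ : ∃ j, k = j + 1 := ⟨k - 1, by omega⟩
  rw [zGen_succ]
  cases k with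
  | zero => simp [deconc_mul, edgeSeries_one, mul_assoc, add_comm]
  | succ k =>
    rw [← mul_assoc, deconc_mul_genX_pow, deconc_mul, if_pos rfl, edgeSeries_succ_succ,
      pow_succ _ (k + 1)]
    simp only [mul_assoc, mul_neg, neg_smul, mul_one, smul_neg]

/-! ### The symmetrization map in terms of `deconc` -/

lemma sum_piAntidiag_fin_succ {M : Type*} [AddCommMonoid M] (m n : ℕ)
    (f : (Fin (m + 1) → ℕ) → M) :
    ∑ l ∈ piAntidiag (univ : Finset (Fin (m + 1))) n, f l =
      ∑ p ∈ antidiagonal n, ∑ l ∈ piAntidiag (univ : Finset (Fin m)) p.1,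
        f (Fin.cons p.2 l) := by
  rw [Finset.sum_sigma']
  refine Finset.sum_bij' (fun l _ => ⟨(∑ i, Fin.tail l i, l 0), Fin.tail l⟩)
    (fun x _ => Fin.cons x.1.2 x.2) ?_ ?_ ?_ ?_ ?_
  · intro l hl
    simp only [mem_piAntidiag, Fin.sum_univ_succ] at hl
    simp only [mem_sigma, HasAntidiagonal.mem_antidiagonal, mem_piAntidiag, Fin.tail]
    exact ⟨by rw [← hl.1, add_comm], rfl, fun _ _ => mem_univ _⟩
  · rintro ⟨⟨p, q⟩, l⟩ hl
    simp only [mem_sigma, HasAntidiagonal.mem_antidiagonal, mem_piAntidiag] at hl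
    simp only [mem_piAntidiag, Fin.sum_univ_succ, Fin.cons_zero, Fin.cons_succ]
    exact ⟨by rw [hl.2.1, ← hl.1, add_comm], fun _ _ => mem_univ _⟩
  · intro l hl
    simp
  · rintro ⟨⟨p, q⟩, l⟩ hl
    simp only [mem_sigma, HasAntidiagonal.mem_antidiagonal, mem_piAntidiag] at hl
    simp [← hl.2.1]
  · intro l hl
    simp

/-- The generating series of `revSeriesCoeff`. -/
def revSeries (k : List ℕ) : PowerSeries HAlg := ((k.map fun j => edgeSeries j 1).reverse).prod

lemma zIndex_append (k k' : List ℕ) : zIndex (k ++ k') = zIndex k * zIndex k' := by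
  simp [zIndex]

lemma zIndex_singleton (j : ℕ) : zIndex [j] = zGen j := by
  simp [zIndex]

lemma revSeriesCoeff_eq (k : List ℕ) (n : ℕ) :
    revSeriesCoeff k n = PowerSeries.coeff n (revSeries k) := by
  induction k generalizing n with
  | nil =>
    cases n with
    | zero => simp [revSeriesCoeff, revSeries, zIndex]
    | succ n => simp [revSeriesCoeff, revSeries, zIndex, PowerSeries.coeff_one]
  | cons j k ih =>
    have h : revSeries (j :: k) = revSeries k * edgeSeries j 1 := by simp [revSeries]
    rw [h, PowerSeries.coeff_mul, revSeriesCoeff]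
    refine (sum_piAntidiag_fin_succ k.length n _).trans ?_
    refine Finset.sum_congr rfl fun p _ => ?_
    rw [← ih, revSeriesCoeff, Finset.sum_mul]
    refine Finset.sum_congr rfl fun l _ => ?_
    have e : List.ofFn (fun i : Fin (j :: k).length =>
        (j :: k).get i + (Fin.cons p.2 l : Fin (k.length + 1) → ℕ) i) =
        (j + p.2) :: List.ofFn (fun i => k.get i + l i) := by
      simp [List.ofFn_succ]
    have e' : ∏ i : Fin (j :: k).length, ((j :: k).get i +
        (Fin.cons p.2 l : Fin (k.length + 1) → ℕ) i - 1).choose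
          ((Fin.cons p.2 l : Fin (k.length + 1) → ℕ) i) =
        (j + p.2 - 1).choose p.2 * ∏ i, (k.get i + l i - 1).choose (l i) :=
      Fin.prod_univ_succ (n := k.length) _
    rw [e, e', List.reverse_cons, zIndex_append, zIndex_singleton]
    simp [edgeSeries, zGen, genY, smul_smul]

lemma deconc_zIndex (k : List ℕ) (hk : ∀ j ∈ k, 0 < j) (g : PowerSeries HAlg) :
    deconc (zIndex k) 1 g = ∑ i ∈ range k.length,
      (-1 : ℚ) ^ (k.drop i).sum • act (zIndex (k.take i)) (g * revSeries (k.drop i)) := by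
  induction k using List.reverseRecOn generalizing g with
  | nil => simp [zIndex, deconc_one]
  | append_singleton k j ih =>
    rw [zIndex_append, zIndex_singleton, deconc_mul_zGen _ (hk j (by simp)),
      ih (fun i hi => hk i (by simp [hi])), List.length_append, List.length_singleton,
      Finset.sum_range_succ, smul_add, Finset.smul_sum, add_comm]
    congr 1
    · refine Finset.sum_congr rfl fun i hi => ?_
      have hi' : i ≤ k.length := (Finset.mem_range.1 hi).le
      rw [List.drop_append_of_le_length hi', List.take_append_of_le_length hi', smul_smul,
        ← pow_add, List.sum_append, List.sum_singleton, add_comm]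
      simp [revSeries, mul_assoc]
    · simp [revSeries]

/-- The summand `i = r` of `φ̂`, where nothing is reversed, gives the constant; the others are the
terms released by `deconc` at each block. -/
lemma phiHatIndex_eq (k : List ℕ) (hk : ∀ j ∈ k, 0 < j) :
    phiHatIndex k = PowerSeries.C (zIndex k) + deconc (zIndex k) 1 1 := by
  ext n
  rw [phiHatIndex, PowerSeries.coeff_mk, Finset.sum_range_succ, add_comm, map_add,
    deconc_zIndex k hk, map_sum]
  congr 1
  · rw [List.drop_length, List.take_length, revSeriesCoeff_eq]
    simp [revSeries, PowerSeries.coeff_one, PowerSeries.coeff_C]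
    split_ifs <;> simp [shuffle_one]
  · simp [revSeriesCoeff_eq]

/-- The coercion of a list of positive integers to natural numbers goes through the list monad; this
brings it into the form of a map. -/
lemma bind_pure_coe (k : List ℕ+) : (do let a ← k; pure (a : ℕ) : List ℕ) = k.map PNat.val := by
  induction k with
  | nil => rfl
  | cons j k ih => simpa using ih

lemma zWord_cons (j : ℕ+) (k : List ℕ+) :
    zWord (j :: k) = FreeMonoid.of 1 * FreeMonoid.of 0 ^ ((j : ℕ) - 1) * zWord k := by
  simp [zWord]

lemma basisFreeMonoid_zWord (k : List ℕ+) :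
    FreeAlgebra.basisFreeMonoid ℚ (Fin 2) (zWord k) = zIndex (k.map PNat.val) := by
  have h (w : FreeMonoid (Fin 2)) : FreeAlgebra.basisFreeMonoid ℚ (Fin 2) w =
      FreeMonoid.lift (FreeAlgebra.ι ℚ) w := by
    rw [basisFreeMonoid_apply, FreeMonoid.lift_apply]
  rw [h]
  induction k with
  | nil => simp [zWord, zIndex]
  | cons j k ih =>
    rw [zWord_cons, map_mul, ih, List.map_cons, zIndex, zIndex, List.map_cons, List.prod_cons]
    simp [zGen, genX, genY]

lemma replicate_append_inj {a b : ℕ} {u v : List (Fin 2)} (hu : u.head? ≠ some 0)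
    (hv : v.head? ≠ some 0) (h : List.replicate a 0 ++ u = List.replicate b 0 ++ v) :
    a = b ∧ u = v := by
  induction a generalizing b with
  | zero =>
    cases b with
    | zero => simpa using h
    | succ b => simp [List.replicate_succ] at h; simp [h] at hu
  | succ a ih =>
    cases b with
    | zero => simp [List.replicate_succ] at h; simp [← h] at hv
    | succ b =>
      simp only [List.replicate_succ, List.cons_append, List.cons.injEq, true_and] at h
      simpa using ih h

lemma toList_zWord_cons (j : ℕ+) (k : List ℕ+) :
    (zWord (j :: k)).toList = 1 :: (List.replicate ((j : ℕ) - 1) 0 ++ (zWord k).toList) := by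
  have h (n : ℕ) : (FreeMonoid.of (0 : Fin 2) ^ n).toList = List.replicate n 0 := by
    induction n with
    | zero => rfl
    | succ n ih => rw [pow_succ', FreeMonoid.toList_mul, ih, List.replicate_succ]; rfl
  rw [zWord_cons, mul_assoc, FreeMonoid.toList_mul,
    FreeMonoid.toList_mul, h]
  rfl

/-- The length of the run of `x` after the first `y` determines the first part of the index.
Injectivity ensures that `Function.extend` in `phiHatOnH1` takes the prescribed values. -/
lemma zWord_injective : Function.Injective zWord := by
  have hd (k : List ℕ+) : (zWord k).toList.head? ≠ some 0 := by
    cases k with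
    | nil => simp [zWord]
    | cons j k => rw [toList_zWord_cons]; simp
  intro k
  induction k with
  | nil =>
    intro k' h
    cases k' with
    | nil => rfl
    | cons j k' =>
      have := congrArg FreeMonoid.toList h
      rw [toList_zWord_cons] at this
      simp [zWord] at this
  | cons i k ih =>
    intro k' h
    have h := congrArg FreeMonoid.toList h
    cases k' with
    | nil => rw [toList_zWord_cons] at h; simp [zWord] at h
    | cons j k' =>
      rw [toList_zWord_cons, toList_zWord_cons, List.cons.injEq] at h
      obtain ⟨h1, h2⟩ := replicate_append_inj (hd k) (hd k') h.2
      have hij : i = j := by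
        apply PNat.coe_injective
        have := i.pos
        have := j.pos
        omega
      rw [hij, ih (FreeMonoid.toList.injective h2)]

lemma phiHatOnH1_zIndex (k : List ℕ+) :
    phiHatOnH1 (zIndex (k.map PNat.val)) =
      PowerSeries.C (zIndex (k.map PNat.val)) +
        deconc (zIndex (k.map PNat.val)) 1 1 := by
  conv_lhs => rw [← basisFreeMonoid_zWord, phiHatOnH1, Module.Basis.constr_basis,
    zWord_injective.extend_apply]
  simp only [bind_pure_coe, List.map_id']
  refine phiHatIndex_eq _ fun j hj => ?_
  obtain ⟨i, _, rfl⟩ := List.mem_map.1 hj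
  exact i.pos

/-- The last part `j` is kept separate because appending `x` raises it by one, while appending `y`
starts a new part `1`. -/
lemma exists_zIndex_eq (u : List (Fin 2)) :
    ∃ (k : List ℕ+) (j : ℕ+), genY * revWord u = zIndex ((k ++ [j]).map PNat.val) := by
  induction u with
  | nil => exact ⟨[], 1, by simp [zIndex, zGen]⟩
  | cons c u ih =>
    obtain ⟨k, j, h⟩ := ih
    rw [revWord_cons, ← mul_assoc, h]
    fin_cases c
    · refine ⟨k, j + 1, ?_⟩
      obtain ⟨m, hm⟩ : ∃ m, (j : ℕ) = m + 1 := ⟨j - 1, by have := j.pos; omega⟩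
      simp only [List.map_append, zIndex_append, List.map_cons, List.map_nil, zIndex_singleton,
        PNat.add_coe, hm, PNat.one_coe, zGen_succ, pow_succ, mul_assoc]
      rfl
    · refine ⟨k ++ [j], 1, ?_⟩
      rw [List.map_append (l₁ := k ++ [j]), zIndex_append (List.map _ (k ++ [j]))]
      simp [zIndex_singleton, zGen, genY]

lemma phiHatOnH1_eq {a : HAlg} (ha : a ∈ HOne) :
    phiHatOnH1 a = PowerSeries.C a + deconc a 1 1 := by
  let f : HAlg →ₗ[ℚ] PowerSeries HAlg :=
    { toFun := fun a => PowerSeries.C a + deconc a 1 1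
      map_add' := fun a b => by simp; abel
      map_smul' := fun q a => by
        ext n; simp [PowerSeries.coeff_C, smul_add] }
  have h : HOne ≤ LinearMap.eqLocus phiHatOnH1 f := by
    refine sup_le (Submodule.span_le.2 ?_) ?_
    · rintro _ rfl
      exact phiHatOnH1_zIndex []
    · rintro _ ⟨b, rfl⟩
      have h' : phiHatOnH1.comp (LinearMap.mulLeft ℚ genY) =
          f.comp (LinearMap.mulLeft ℚ genY) := by
        refine ext_revWord fun u => ?_
        obtain ⟨k, j, h⟩ := exists_zIndex_eq u
        simp only [LinearMap.comp_apply, LinearMap.mulLeft_apply, h]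
        exact phiHatOnH1_zIndex _
      exact LinearMap.congr_fun h' b
  exact h ha

lemma phiHat_C (a : HAlg) : phiHat (PowerSeries.C a) = phiHatOnH1 a := by
  ext n
  rw [phiHat, PowerSeries.coeff_mk, Finset.sum_eq_single (0, n)]
  · simp
  · rintro ⟨i, j⟩ hij hne
    have hi : i ≠ 0 := by
      rintro rfl
      simp at hij
      simp [hij] at hne
    simp [PowerSeries.coeff_C, hi]
  · simp

/-! ### The subspaces `ℌ¹` and `y ℌ` -/

/-- The subspace `y ℌ` of `ℌ¹`. -/
def HPlus : Submodule ℚ HAlg := LinearMap.range (LinearMap.mulLeft ℚ genY)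

lemma HPlus_le : HPlus ≤ HOne := le_sup_right

lemma one_mem_HOne : (1 : HAlg) ∈ HOne :=
  (le_sup_left : _ ≤ HOne) (Submodule.subset_span rfl)

lemma mul_mem_HPlus {a : HAlg} (ha : a ∈ HPlus) (b : HAlg) : a * b ∈ HPlus := by
  obtain ⟨c, rfl⟩ := ha
  exact ⟨c * b, by simp [mul_assoc]⟩

lemma zGen_mem_HPlus (k : ℕ) : zGen k ∈ HPlus := ⟨genX ^ (k - 1), by simp [zGen]⟩

lemma mul_zGen_mem_HPlus {a : HAlg} (ha : a ∈ HOne) (k : ℕ) : a * zGen k ∈ HPlus := by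
  obtain ⟨b, hb, c, hc, rfl⟩ := Submodule.mem_sup.1 ha
  obtain ⟨q, rfl⟩ := Submodule.mem_span_singleton.1 hb
  rw [add_mul]
  refine add_mem ?_ (mul_mem_HPlus hc _)
  rw [smul_mul_assoc, one_mul]
  exact Submodule.smul_mem _ _ (zGen_mem_HPlus k)

/-- A word of the shuffle begins with the first letter of one of the two words, hence with `y`. As
the recursion works on last letters, the proof is by induction on the total length. -/
lemma shuffle_mem_HPlus_of_HPlus {a b : HAlg} (ha : a ∈ HPlus) (hb : b ∈ HPlus) :
    shuffle a b ∈ HPlus := by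
  obtain ⟨a, rfl⟩ := ha
  obtain ⟨b, rfl⟩ := hb
  simp only [LinearMap.mulLeft_apply]
  induction a using revWord_induction with
  | add a a' h h' => rw [mul_add, map_add, LinearMap.add_apply]; exact add_mem h h'
  | smul q a h =>
    rw [mul_smul_comm, map_smul, LinearMap.smul_apply]; exact Submodule.smul_mem _ _ h
  | word u =>
  induction b using revWord_induction with
  | add a a' h h' => rw [mul_add, map_add]; exact add_mem h h'
  | smul q a h => rw [mul_smul_comm, map_smul]; exact Submodule.smul_mem _ _ h
  | word v =>
  have hm (u : List (Fin 2)) : genY * revWord u ∈ HPlus := ⟨_, rfl⟩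
  have hsplit (u : List (Fin 2)) : ∃ a c, genY * revWord u = a * FreeAlgebra.ι ℚ c ∧
      (u = [] ∧ a = 1 ∨ ∃ u', u'.length < u.length ∧ a = genY * revWord u') := by
    cases u with
    | nil => exact ⟨1, 1, by simp [genY], Or.inl ⟨rfl, rfl⟩⟩
    | cons c u => exact ⟨genY * revWord u, c, by rw [revWord_cons, mul_assoc],
        Or.inr ⟨u, by simp, rfl⟩⟩
  induction hn : u.length + v.length using Nat.strong_induction_on generalizing u v with
  | _ n ih =>
    obtain ⟨a, c, ha, ha'⟩ := hsplit u
    obtain ⟨b, d, hb, hb'⟩ := hsplit v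
    rw [ha, hb, shuffle_mul_mul, ← ha, ← hb]
    refine add_mem (mul_mem_HPlus ?_ _) (mul_mem_HPlus ?_ _)
    · rcases ha' with ⟨-, rfl⟩ | ⟨u', hu', rfl⟩
      · rw [one_shuffle]; exact hm v
      · exact ih _ (by omega) u' v rfl
    · rcases hb' with ⟨-, rfl⟩ | ⟨v', hv', rfl⟩
      · rw [shuffle_one]; exact hm u
      · exact ih _ (by omega) u v' rfl

lemma shuffle_mem_HPlus {a b : HAlg} (ha : a ∈ HPlus) (hb : b ∈ HOne) :
    shuffle a b ∈ HPlus := by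
  obtain ⟨c, hc, d, hd, rfl⟩ := Submodule.mem_sup.1 hb
  obtain ⟨q, rfl⟩ := Submodule.mem_span_singleton.1 hc
  rw [map_add, map_smul, shuffle_one]
  exact add_mem (Submodule.smul_mem _ _ ha) (shuffle_mem_HPlus_of_HPlus ha hd)

lemma shuffle_mem_HOne {a b : HAlg} (ha : a ∈ HOne) (hb : b ∈ HOne) : shuffle a b ∈ HOne := by
  obtain ⟨c, hc, d, hd, rfl⟩ := Submodule.mem_sup.1 ha
  obtain ⟨q, rfl⟩ := Submodule.mem_span_singleton.1 hc
  rw [map_add, map_smul, LinearMap.add_apply, LinearMap.smul_apply, one_shuffle]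
  exact add_mem (Submodule.smul_mem _ _ hb) (HPlus_le (shuffle_mem_HPlus hd hb))

/-! ### Shuffle products over finite sets -/

/-- `ℌ` with the shuffle product as its multiplication. -/
def ShuffleAlg : Type := HAlg

instance : CommMonoid ShuffleAlg where
  mul a b := shuffle (a : HAlg) (b : HAlg)
  one := (1 : HAlg)
  mul_assoc := shuffle_assoc
  one_mul := one_shuffle
  mul_one := shuffle_one
  mul_comm := shuffle_comm

/-- The shuffle product of a finite family. -/
def shuffleProd {ι : Type*} (s : Finset ι) (f : ι → HAlg) : HAlg :=
  Finset.prod (M := ShuffleAlg) s f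

section shuffleProd

variable {ι κ : Type*}

lemma shuffleList_toList (s : Finset ι) (f : ι → HAlg) :
    shuffleList (s.toList.map f) = shuffleProd s f :=
  Finset.prod_map_toList (M := ShuffleAlg) s f

@[simp] lemma shuffleProd_empty (f : ι → HAlg) : shuffleProd ∅ f = 1 := rfl

lemma shuffleProd_insert [DecidableEq ι] {s : Finset ι} {i : ι} (hi : i ∉ s) (f : ι → HAlg) :
    shuffleProd (insert i s) f = shuffle (f i) (shuffleProd s f) :=
  Finset.prod_insert (M := ShuffleAlg) hi

@[simp] lemma shuffleProd_singleton (i : ι) (f : ι → HAlg) : shuffleProd {i} f = f i :=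
  Finset.prod_singleton (M := ShuffleAlg) f i

lemma shuffleProd_congr {s t : Finset ι} {f g : ι → HAlg} (h : s = t)
    (hfg : ∀ i ∈ t, f i = g i) : shuffleProd s f = shuffleProd t g :=
  Finset.prod_congr (M := ShuffleAlg) h hfg

lemma shuffleProd_union [DecidableEq ι] {s t : Finset ι} (h : Disjoint s t) (f : ι → HAlg) :
    shuffleProd (s ∪ t) f = shuffle (shuffleProd s f) (shuffleProd t f) :=
  Finset.prod_union (M := ShuffleAlg) h

lemma shuffle_shuffleProd_erase [DecidableEq ι] {s : Finset ι} {i : ι} (hi : i ∈ s)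
    (f : ι → HAlg) : shuffle (f i) (shuffleProd (s.erase i) f) = shuffleProd s f :=
  Finset.mul_prod_erase (M := ShuffleAlg) s f hi

lemma shuffleProd_image [DecidableEq κ] (s : Finset ι) {e : ι → κ} (he : Function.Injective e)
    (f : κ → HAlg) : shuffleProd (s.image e) f = shuffleProd s fun i => f (e i) :=
  Finset.prod_image (M := ShuffleAlg) he.injOn

/-- `deconc` of a shuffle product. -/
lemma deconc_shuffleProd [DecidableEq ι] (s : Finset ι) (f : ι → HAlg) (d : Fin 2)
    (g : PowerSeries HAlg) :
    deconc (shuffleProd s f) d g =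
      ∑ i ∈ s, deconc (f i) d (act (shuffleProd (s.erase i) f) g) := by
  induction s using Finset.induction_on generalizing g with
  | empty => simp [deconc_one]
  | insert i s hi ih =>
    rw [shuffleProd_insert hi, deconc_shuffle, Finset.sum_insert hi, Finset.erase_insert hi, ih]
    congr 1
    refine Finset.sum_congr rfl fun j hj => ?_
    have hij : i ≠ j := fun h => hi (h ▸ hj)
    rw [Finset.erase_insert_of_ne hij, shuffleProd_insert (fun h => hi (mem_of_mem_erase h)),
      act_shuffle, act_comm]

end shuffleProd

namespace Pair

/-! ### Rooted trees given by a parent function -/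

/-- A description of a rooted tree by a function that sends a vertex to its parent, together with a
function that increases from parents to children. -/
structure Rooting (P : Pair.{u}) where
  par : P.V → P.V
  d : P.V → ℕ
  adj : ∀ x y, P.G.Adj x y ↔ (x ≠ P.rt ∧ par x = y) ∨ (y ≠ P.rt ∧ par y = x)
  lt : ∀ x, x ≠ P.rt → d (par x) < d x

open Classical in
/-- The factor of an edge from `c` to its parent `p` in the definition of `w`. -/
def plainFactor (P : Pair.{u}) (c p : P.V) : HAlg :=
  if c ∈ P.black then zGen (P.k s(p, c)) else genX ^ P.k s(p, c)

namespace Rooting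

variable {P : Pair.{u}} (r : P.Rooting)

open Classical in
/-- The children of a vertex. -/
def kids (v : P.V) : Finset P.V := univ.filter fun c => c ≠ P.rt ∧ r.par c = v

variable {r}

lemma mem_kids {c v : P.V} : c ∈ r.kids v ↔ c ≠ P.rt ∧ r.par c = v := by simp [kids]

lemma lt_of_mem_kids {c v : P.V} (h : c ∈ r.kids v) : r.d v < r.d c := by
  obtain ⟨h1, rfl⟩ := mem_kids.1 h
  exact r.lt c h1

variable (r)

lemma par_ne {x : P.V} (h : x ≠ P.rt) : r.par x ≠ x := fun e => by
  have := r.lt x h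
  rw [e] at this
  omega

lemma par_par_ne {x : P.V} (h : x ≠ P.rt) (h' : r.par x ≠ P.rt) : r.par (r.par x) ≠ x := fun e => by
  have h1 := r.lt x h
  have h2 := r.lt _ h'
  rw [e] at h2
  omega

lemma adj_par {x : P.V} (h : x ≠ P.rt) : P.G.Adj x (r.par x) := (r.adj _ _).2 (Or.inl ⟨h, rfl⟩)

/-- Induction from the root to the leaves. -/
lemma par_induction {p : P.V → Prop} (root : p P.rt) (step : ∀ v, v ≠ P.rt → p (r.par v) → p v)
    (v : P.V) : p v := by
  induction hn : r.d v using Nat.strong_induction_on generalizing v with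
  | _ n ih =>
    by_cases h : v = P.rt
    · rwa [h]
    · exact step v h (ih _ (hn ▸ r.lt v h) _ rfl)

/-- The number of vertices at a level above that of `v`. -/
def above (v : P.V) : ℕ := (univ.filter fun x => r.d v < r.d x).card

variable {r} in
lemma above_lt {c v : P.V} (h : c ∈ r.kids v) : r.above c < r.above v := by
  have h' := lt_of_mem_kids h
  refine Finset.card_lt_card ⟨fun x hx => ?_, fun hs => ?_⟩
  · simp only [mem_filter, mem_univ, true_and] at hx ⊢
    omega
  · have := hs (x := c) (by simpa using h')
    simp at this

lemma above_lt_card (v : P.V) : r.above v < Fintype.card P.V := by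
  refine Finset.card_lt_card ⟨Finset.subset_univ _, fun h => ?_⟩
  simpa using h (mem_univ v)

/-- Induction from the leaves to the root. -/
lemma kids_induction {p : P.V → Prop} (step : ∀ v, (∀ c ∈ r.kids v, p c) → p v) (v : P.V) :
    p v := by
  induction hn : r.above v using Nat.strong_induction_on generalizing v with
  | _ n ih => exact step v fun c hc => ih _ (hn ▸ above_lt hc) _ rfl

/-- `F v` is the shuffle product of the `F c * m c v` for the children `c` of `v`. -/
def IsEval (m : P.V → P.V → HAlg) (F : P.V → HAlg) : Prop :=
  ∀ v, F v = shuffleProd (r.kids v) fun c => F c * m c v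

variable {r} in
lemma IsEval.unique {m : P.V → P.V → HAlg} {F F' : P.V → HAlg} (h : r.IsEval m F)
    (h' : r.IsEval m F') : F = F' := by
  funext v
  induction v using r.kids_induction with
  | step v ih =>
    rw [h v, h' v]
    exact shuffleProd_congr rfl fun c hc => by rw [ih c hc]

/-- The recursion of `IsEval`, up to a given number of levels. -/
def evalAux (m : P.V → P.V → HAlg) : ℕ → P.V → HAlg
  | 0, _ => 1
  | n + 1, v => shuffleProd (r.kids v) fun c => evalAux m n c * m c v

/-- `above` drops from a vertex to its children, so the bound on the number of levels is irrelevant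
once it exceeds `above v`. -/
lemma evalAux_eq (m : P.V → P.V → HAlg) {n n' : ℕ} {v : P.V} (h : r.above v < n)
    (h' : r.above v < n') : r.evalAux m n v = r.evalAux m n' v := by
  induction n generalizing n' v with
  | zero => omega
  | succ n ih =>
    cases n' with
    | zero => omega
    | succ n' =>
      refine shuffleProd_congr rfl fun c hc => ?_
      have := above_lt hc
      rw [ih (n' := n') (v := c) (by omega) (by omega)]

lemma exists_isEval (m : P.V → P.V → HAlg) : ∃ F, r.IsEval m F := by
  refine ⟨r.evalAux m (Fintype.card P.V + 1), fun v => ?_⟩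
  refine shuffleProd_congr rfl fun c _ => ?_
  rw [r.evalAux_eq m (r.above_lt_card c) (lt_trans (r.above_lt_card c) (Nat.lt_succ_self _))]

/-! ### Paths to the root -/

/-- `v` lies on the path from `w` to the root. -/
def IsAncestor (v w : P.V) : Prop :=
  Relation.ReflTransGen (fun a b => a ≠ P.rt ∧ r.par a = b) w v

/-- The only way out of the part of the tree above `v` is the edge from `v` to its parent. -/
lemma isAncestor_of_walk {v : P.V} {w x : P.V} (q : P.G.Walk w x) (hw : r.IsAncestor v w)
    (hv : v ∉ q.support) : r.IsAncestor v x := by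
  induction q with
  | nil => exact hw
  | @cons w w' x h q ih =>
    rw [SimpleGraph.Walk.support_cons, List.mem_cons, not_or] at hv
    refine ih ?_ hv.2
    rcases (r.adj _ _).1 h with ⟨h1, h2⟩ | ⟨h1, h2⟩
    · rcases Relation.ReflTransGen.cases_head hw with h3 | ⟨y, ⟨h3, h4⟩, h5⟩
      · exact absurd h3.symm hv.1
      · rw [← h2, h4]; exact h5
    · exact Relation.ReflTransGen.head ⟨h1, h2⟩ hw

lemma isAncestor_root {v : P.V} (h : r.IsAncestor v P.rt) : v = P.rt := by
  rcases Relation.ReflTransGen.cases_head h with h3 | ⟨y, ⟨h3, _⟩, _⟩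
  · exact h3.symm
  · exact absurd rfl h3

lemma exists_unique_path (v : P.V) : ∃ q : P.G.Walk v P.rt, q.IsPath ∧
    (∀ x ∈ q.support, r.d x ≤ r.d v) ∧ ∀ q' : P.G.Walk v P.rt, q'.IsPath → q' = q := by
  induction v using r.par_induction with
  | root =>
    refine ⟨.nil, SimpleGraph.Walk.IsPath.nil, by simp, fun q' hq' => ?_⟩
    exact SimpleGraph.Walk.eq_nil_iff_nil.2 (SimpleGraph.Walk.isPath_iff_nil.1 hq')
  | step v hv ih =>
    obtain ⟨q, hq, hd, hu⟩ := ih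
    have hlt := r.lt v hv
    refine ⟨.cons (r.adj_par hv) q, ?_, ?_, ?_⟩
    · rw [SimpleGraph.Walk.cons_isPath_iff]
      exact ⟨hq, fun h => by have := hd v h; omega⟩
    · intro x hx
      rw [SimpleGraph.Walk.support_cons, List.mem_cons] at hx
      rcases hx with rfl | hx
      · exact le_rfl
      · have := hd x hx; omega
    · intro q' hq'
      cases q' with
      | nil => exact absurd rfl hv
      | @cons _ w _ h q' =>
        rw [SimpleGraph.Walk.cons_isPath_iff] at hq'
        have hw : r.par v = w := by
          rcases (r.adj _ _).1 h with ⟨_, h2⟩ | ⟨h1, h2⟩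
          · exact h2
          -- A path that starts with a step to a child stays above `v` and cannot reach the root.
          · have := r.isAncestor_of_walk q' (v := v) (.single ⟨h1, h2⟩) hq'.2
            exact absurd (r.isAncestor_root this) hv
        subst hw
        rw [hu q' hq'.1]

lemma path_root : P.path P.rt P.rt = ∅ := by
  ext e
  simp only [path, mem_filter, mem_univ, true_and, notMem_empty, iff_false, not_exists, not_and]
  intro p hp
  rw [SimpleGraph.Walk.eq_nil_iff_nil.2 (SimpleGraph.Walk.isPath_iff_nil.1 hp)]
  simp

lemma mem_path {v : P.V} {e : Sym2 P.V} (hv : v ≠ P.rt) :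
    e ∈ P.path P.rt v ↔ e = s(v, r.par v) ∨ e ∈ P.path P.rt (r.par v) := by
  have key (w : P.V) (q : P.G.Walk w P.rt) (hq : q.IsPath)
      (hu : ∀ q' : P.G.Walk w P.rt, q'.IsPath → q' = q) : e ∈ P.path P.rt w ↔ e ∈ q.edges := by
    simp only [path, mem_filter, mem_univ, true_and]
    constructor
    · rintro ⟨p, hp, he⟩
      rw [← hu p.reverse hp.reverse]
      simpa using he
    · intro he
      exact ⟨q.reverse, hq.reverse, by simpa using he⟩
  obtain ⟨q, hq, hd, hu⟩ := r.exists_unique_path (r.par v)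
  obtain ⟨q₁, hq₁, -, hu₁⟩ := r.exists_unique_path v
  have hlt := r.lt v hv
  have h : (SimpleGraph.Walk.cons (r.adj_par hv) q).IsPath := by
    rw [SimpleGraph.Walk.cons_isPath_iff]
    exact ⟨hq, fun h => by have := hd v h; omega⟩
  rw [key v q₁ hq₁ hu₁, key _ q hq hu, ← hu₁ _ h, SimpleGraph.Walk.edges_cons, List.mem_cons]

lemma d_le_of_mem_path {v x : P.V} {e : Sym2 P.V} (he : e ∈ P.path P.rt v) (hx : x ∈ e) :
    r.d x ≤ r.d v := by
  induction v using r.par_induction with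
  | root => simp [path_root] at he
  | step v hv ih =>
    have hlt := r.lt v hv
    rcases (r.mem_path hv).1 he with rfl | he
    · rcases Sym2.mem_iff.1 hx with rfl | rfl <;> omega
    · have := ih he; omega

lemma notMem_path_par {v : P.V} (hv : v ≠ P.rt) (y : P.V) : s(v, y) ∉ P.path P.rt (r.par v) :=
  fun h => by
    have := r.d_le_of_mem_path h (Sym2.mem_mk_left v y)
    have := r.lt v hv
    omega

lemma path_eq_insert [DecidableEq (Sym2 P.V)] {v : P.V} (hv : v ≠ P.rt) :
    P.path P.rt v = insert s(v, r.par v) (P.path P.rt (r.par v)) := by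
  ext e
  rw [r.mem_path hv, mem_insert]

lemma isParent_iff {p v : P.V} : P.IsParent p v ↔ v ≠ P.rt ∧ r.par v = p := by
  unfold IsParent
  by_cases hv : v = P.rt
  · subst hv; simp [path_root]
  · rw [r.mem_path hv]
    simp only [hv, ne_eq, not_false_eq_true, true_and, r.notMem_path_par hv p, or_false]
    constructor
    · intro h
      exact (Sym2.congr_right.1 h).symm
    · rintro rfl; rfl

lemma children_eq (v : P.V) : P.children v = r.kids v := by
  ext c
  simp [children, kids, r.isParent_iff]

/-! ### The element `w` by means of a rooting -/

lemma wAbove_eq (n : ℕ) (v : P.V) : P.wAbove n v = r.evalAux P.plainFactor n v := by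
  induction n generalizing v with
  | zero => rfl
  | succ n ih =>
    rw [wAbove, shuffleList_toList, r.children_eq]
    refine shuffleProd_congr rfl fun c _ => ?_
    rw [ih, plainFactor]

/-- Solutions of the recursion are unique, so `w` may be read off from any rooting and any solution.
-/
lemma w_eq {F : P.V → HAlg} (hF : r.IsEval P.plainFactor F) : P.w = F P.rt := by
  have h : r.IsEval P.plainFactor (r.evalAux P.plainFactor (Fintype.card P.V)) := by
    intro v
    rw [r.evalAux_eq _ (r.above_lt_card v) (lt_trans (r.above_lt_card v) (Nat.lt_succ_self _))]
    rfl
  rw [hF.unique h, w, r.wAbove_eq]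

end Rooting

/-- Every tree has a rooting. -/
lemma exists_rooting (P : Pair.{u}) (h : P.G.IsTree) : Nonempty P.Rooting := by
  let p (v : P.V) : P.G.Walk v P.rt := (h.existsUnique_path v P.rt).choose
  have hp (v : P.V) : (p v).IsPath := (h.existsUnique_path v P.rt).choose_spec.1
  have hu (v : P.V) (q : P.G.Walk v P.rt) (hq : q.IsPath) : q = p v :=
    (h.existsUnique_path v P.rt).choose_spec.2 q hq
  have hnil (v : P.V) (hv : v ≠ P.rt) : ¬ (p v).Nil := fun hn => hv hn.eq
  refine ⟨⟨fun v => (p v).snd, fun v => (p v).length, fun x y => ⟨fun hxy => ?_, ?_⟩,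
    fun x hx => ?_⟩⟩
  · by_cases hy : y ∈ (p x).support
    · refine Or.inl ⟨?_, (h.isAcyclic.eq_snd_of_adj_start (hp x) hxy hy).symm⟩
      rintro rfl
      rw [SimpleGraph.Walk.eq_nil_iff_nil.2 (SimpleGraph.Walk.isPath_iff_nil.1 (hp P.rt))] at hy
      rw [SimpleGraph.Walk.support_nil, List.mem_singleton] at hy
      exact hxy.ne hy.symm
    · refine Or.inr ⟨?_, ?_⟩
      · rintro rfl
        exact hy (p x).end_mem_support
      · rw [← hu y (.cons hxy.symm (p x)) ((SimpleGraph.Walk.cons_isPath_iff _ _).2 ⟨hp x, hy⟩)]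
        simp
  · rintro (⟨hx, rfl⟩ | ⟨hy, rfl⟩)
    · exact (p x).adj_snd (hnil x hx)
    · exact ((p y).adj_snd (hnil y hy)).symm
  · rw [← hu _ (p x).tail (hp x).tail, ← SimpleGraph.Walk.length_tail_add_one (hnil x hx)]
    exact Nat.lt_succ_self _


/-! ### Insertion of a white vertex -/

/-- `Q` is, up to renaming, obtained from `P` by the insertion of the white vertex `n` at `v`. Here
`i` is the inclusion of the old vertices, and `j` is its inverse with `j n = v`. -/
structure IsInsertion (P Q : Pair.{u}) (v : P.V) (n : Q.V) (i : P.V → Q.V) (j : Q.V → P.V) :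
    Prop where
  ji : ∀ x, j (i x) = x
  jn : j n = v
  ne : ∀ x, i x ≠ n
  cases : ∀ q, q = n ∨ ∃ x, q = i x
  rt : Q.rt = i P.rt
  adj : ∀ x y, Q.G.Adj (i x) (i y) ↔
    P.G.Adj x y ∧ ¬ (x = v ∧ P.IsParent v y) ∧ ¬ (y = v ∧ P.IsParent v x)
  adj_n : ∀ y, Q.G.Adj n (i y) ↔ y = v ∨ P.IsParent v y
  black : ∀ x, i x ∈ Q.black ↔ x ∈ P.black
  black_n : n ∉ Q.black
  k : ∀ x y, Q.k s(i x, i y) = P.k s(x, y)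
  k_n : ∀ y, y ≠ v → Q.k s(n, i y) = P.k s(v, y)
  k_nv : Q.k s(i v, n) = 0

lemma isInsertion_insertAt (P : Pair.{u}) (v : P.V) : P.IsInsertion (P.insertAt v) v
    (none : Option P.V) (some : P.V → Option P.V) (fun x : Option P.V => x.getD v) where
  ji _ := rfl
  jn := rfl
  ne x := Option.some_ne_none x
  cases q := by
    change Option P.V at q
    cases q with
    | none => exact Or.inl rfl
    | some x => exact Or.inr ⟨x, rfl⟩
  rt := rfl
  adj x y := by
    have h := P.G.adj_comm x y
    have h' : P.G.Adj x y → x ≠ y := fun h => h.ne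
    have key : ((some x : Option P.V) ≠ some y ∧
        ((P.G.Adj x y ∧ ¬ (x = v ∧ P.IsParent v y) ∧ ¬ (y = v ∧ P.IsParent v x)) ∨
        (P.G.Adj y x ∧ ¬ (y = v ∧ P.IsParent v x) ∧ ¬ (x = v ∧ P.IsParent v y)))) ↔
        P.G.Adj x y ∧ ¬ (x = v ∧ P.IsParent v y) ∧ ¬ (y = v ∧ P.IsParent v x) := by
      rw [ne_eq, Option.some.injEq]
      tauto
    exact Iff.trans (SimpleGraph.fromRel_adj _ _ _) key
  adj_n y := by
    have key : ((none : Option P.V) ≠ some y ∧ ((y = v ∨ P.IsParent v y) ∨ False)) ↔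
        y = v ∨ P.IsParent v y := by
      simp
    exact Iff.trans (SimpleGraph.fromRel_adj _ _ _) key
  black x := by
    change some x ∈ P.black.map Function.Embedding.some ↔ _
    simp
  black_n := by
    change none ∉ P.black.map Function.Embedding.some
    simp
  k x y := by
    simp [insertAt]
  k_n y hy := by
    simp [insertAt, hy]
  k_nv := by
    simp [insertAt]

namespace IsInsertion

variable {P Q : Pair.{u}} {v : P.V} {n : Q.V} {i : P.V → Q.V} {j : Q.V → P.V}
  (h : P.IsInsertion Q v n i j) (r : P.Rooting)

lemma injective (h : P.IsInsertion Q v n i j) : Function.Injective i := fun x y e => by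
  rw [← h.ji x, e, h.ji]

open Classical in
/-- The rooting after an insertion. -/
def rooting : Q.Rooting where
  par q := if q = n then i v else
    if j q ≠ P.rt ∧ r.par (j q) = v then n else i (r.par (j q))
  -- Doubling the levels leaves an odd one for the new vertex between `v` and its children.
  d q := if q = n then 2 * r.d v + 1 else 2 * r.d (j q)
  adj x y := by
    have hi (x y) : i x = i y ↔ x = y := h.injective.eq_iff
    have hn := h.ne
    have hn' (x) : n ≠ i x := (h.ne x).symm
    have hp (x : P.V) (hx : x ≠ P.rt) : r.par x ≠ x := r.par_ne hx
    have hpp (x : P.V) (hx : x ≠ P.rt) (hx' : r.par x ≠ P.rt) : r.par (r.par x) ≠ x :=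
      r.par_par_ne hx hx'
    have h1 (p v) : P.IsParent p v ↔ v ≠ P.rt ∧ r.par v = p := r.isParent_iff
    rcases h.cases x with rfl | ⟨x, rfl⟩
    · rcases h.cases y with rfl | ⟨y, rfl⟩
      · simp [hn]
      · simp only [h.adj_n, h.rt, h1, hn, hn', hi, h.ji, if_true, if_false, ne_eq]
        grind
    · rcases h.cases y with rfl | ⟨y, rfl⟩
      · simp only [Q.G.adj_comm (i x), h.adj_n, h.rt, h1, hn, hn', hi, h.ji, if_true, if_false,
          ne_eq]
        grind
      · simp only [h.adj, h.rt, h1, hn, hi, h.ji, if_false, ne_eq, r.adj]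
        grind
  lt x hx := by
    have hn := h.ne
    rcases h.cases x with rfl | ⟨x, rfl⟩
    · simp [hn, h.ji]
    · rw [h.rt, h.injective.ne_iff] at hx
      have := r.lt x hx
      by_cases h1 : r.par x = v
      · simp [hn, h.ji, hx, h1]
        rw [h1] at this; omega
      · simp [hn, h.ji, h1]
        omega

lemma par_n : (h.rooting r).par n = i v := by simp [rooting]

open Classical in
lemma par_i (x : P.V) : (h.rooting r).par (i x) =
    if x ≠ P.rt ∧ r.par x = v then n else i (r.par x) := by
  simp [rooting, h.ne, h.ji]

open Classical in
lemma kids_n : (h.rooting r).kids n = (r.kids v).image i := by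
  have hi (x y) : i x = i y ↔ x = y := h.injective.eq_iff
  have hn := h.ne
  ext y
  simp only [Rooting.mem_kids, mem_image]
  rcases h.cases y with rfl | ⟨y, rfl⟩
  · simp [h.par_n, hn]
  · simp only [h.rt, h.par_i, hi, ne_eq]
    grind

lemma kids_i_self : (h.rooting r).kids (i v) = {n} := by
  classical
  have hi (x y) : i x = i y ↔ x = y := h.injective.eq_iff
  have hn := h.ne
  have hn' (x) : n ≠ i x := (h.ne x).symm
  ext y
  simp only [Rooting.mem_kids, mem_singleton]
  rcases h.cases y with rfl | ⟨y, rfl⟩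
  · simp [h.par_n, h.rt, hn']
  · simp only [h.rt, h.par_i, hi, ne_eq, hn]
    grind

open Classical in
lemma kids_i {x : P.V} (hx : x ≠ v) : (h.rooting r).kids (i x) = (r.kids x).image i := by
  have hi (x y) : i x = i y ↔ x = y := h.injective.eq_iff
  have hn := h.ne
  ext y
  simp only [Rooting.mem_kids, mem_image]
  rcases h.cases y with rfl | ⟨y, rfl⟩
  · simp [h.par_n, hi, hn, Ne.symm hx]
  · simp only [h.rt, h.par_i, hi, ne_eq]
    have := hn x
    grind

/-- The new vertex takes over all branches of `v` and thus its value `F v`. It is then the only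
child of `v`, and its edge contributes the factor `x^0 = 1`. -/
lemma isEval {F : P.V → HAlg} (hF : r.IsEval P.plainFactor F) :
    (h.rooting r).IsEval Q.plainFactor fun q => F (j q) := by
  classical
  intro q
  rcases h.cases q with hq | ⟨x, rfl⟩
  · rw [hq, h.kids_n, shuffleProd_image _ h.injective]
    dsimp only
    rw [h.jn, hF v]
    refine shuffleProd_congr rfl fun c hc => ?_
    have hcv : c ≠ v := fun e => by
      have := Rooting.lt_of_mem_kids hc
      rw [e] at this
      omega
    simp only [h.ji, plainFactor, h.black, h.k_n c hcv]
  · by_cases hx : x = v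
    · subst hx
      rw [h.kids_i_self, shuffleProd_singleton]
      simp [plainFactor, h.black_n, h.k_nv, h.jn, h.ji]
    · rw [h.kids_i r hx, shuffleProd_image _ h.injective]
      dsimp only
      rw [h.ji, hF x]
      refine shuffleProd_congr rfl fun c hc => ?_
      simp only [h.ji, plainFactor, h.black, h.k]

end IsInsertion

/-! ### Joining two edges -/

/-- `Q` is, up to renaming, obtained from `P` by joining the edges `{a, b}` and `{b, c}`. Here `i` is
the inclusion of the vertices of `Q`, and `j` is its inverse. -/
structure IsJoin (P Q : Pair.{u}) (a b c : P.V) (i : Q.V → P.V) (j : P.V → Q.V) : Prop where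
  ji : ∀ q, j (i q) = q
  ij : ∀ x, x ≠ b → i (j x) = x
  ne : ∀ q, i q ≠ b
  rt : i Q.rt = P.rt
  adj : ∀ x y, Q.G.Adj x y ↔ i x ≠ i y ∧ (P.G.Adj (i x) (i y) ∨ s(i x, i y) = s(a, c))
  black : ∀ x, x ∈ Q.black ↔ i x ∈ P.black
  k_ac : ∀ x y, s(i x, i y) = s(a, c) → Q.k s(x, y) = P.k s(a, b) + P.k s(b, c)
  k : ∀ x y, s(i x, i y) ≠ s(a, c) → Q.k s(x, y) = P.k s(i x, i y)

open Classical in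
/-- A retraction of the complement of a vertex. -/
def retract {V : Type u} (b x₀ : V) (h : x₀ ≠ b) (x : V) : {x : V // x ≠ b} :=
  if hx : x ≠ b then ⟨x, hx⟩ else ⟨x₀, h⟩

lemma retract_val {V : Type u} {b x₀ : V} (h : x₀ ≠ b) (x : {x : V // x ≠ b}) :
    retract b x₀ h x.1 = x := by
  simp [retract, x.2]

lemma val_retract {V : Type u} {b x₀ x : V} (h : x₀ ≠ b) (hx : x ≠ b) :
    (retract b x₀ h x).1 = x := by
  simp [retract, hx]

lemma isJoin_join (P : Pair.{u}) (a b c : P.V) (hb : P.rt ≠ b) :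
    P.IsJoin (P.join a b c hb) a b c (Subtype.val : {x : P.V // x ≠ b} → P.V)
      (retract b P.rt hb) where
  ji q := retract_val hb q
  ij x hx := val_retract hb hx
  ne q := q.2
  rt := rfl
  adj x y := and_congr_left' (not_congr Subtype.ext_iff)
  black x := by
    classical
    refine Iff.trans (Finset.mem_filter_univ x) Iff.rfl
  k_ac x y h := if_pos h
  k x y h := if_neg h

namespace IsJoin

variable {P Q : Pair.{u}} {a b c : P.V} {i : Q.V → P.V} {j : P.V → Q.V}
  (h : P.IsJoin Q a b c i j) (r : P.Rooting)

lemma injective (h : P.IsJoin Q a b c i j) : Function.Injective i := fun x y e => by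
  rw [← h.ji x, e, h.ji]

lemma j_eq_iff (h : P.IsJoin Q a b c i j) {x : P.V} (hx : x ≠ b) (q : Q.V) :
    j x = q ↔ x = i q := by
  constructor
  · rintro rfl; rw [h.ij x hx]
  · rintro rfl; exact h.ji q

lemma symm (h : P.IsJoin Q a b c i j) : P.IsJoin Q c b a i j where
  __ := h
  adj x y := by rw [h.adj, Sym2.eq_swap (a := a)]
  k_ac x y e := by
    rw [h.k_ac x y (e.trans Sym2.eq_swap), add_comm, Sym2.eq_swap, Sym2.eq_swap (a := a)]
  k x y e := h.k x y fun e' => e (e'.trans Sym2.eq_swap)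

open Classical in
/-- The rooting after joining the edges of a vertex `b` with parent `a` and only child `c`. -/
def rooting (hb : b ≠ P.rt) (hbc : r.kids b = {c}) (hba : r.par b = a) : Q.Rooting where
  par q := j (if r.par (i q) = b then a else r.par (i q))
  d q := r.d (i q)
  adj x y := by
    have hk (z : P.V) : z ≠ P.rt ∧ r.par z = b ↔ z = c := by
      rw [← Rooting.mem_kids, hbc, mem_singleton]
    have hc := (hk c).2 rfl
    have h1 := r.lt b hb
    have h2 := r.lt c hc.1
    have hab : a ≠ b := fun e => r.par_ne hb (hba.trans e)
    have hj (x) : (if r.par (i x) = b then a else r.par (i x)) ≠ b := by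
      split_ifs with h3
      · exact hab
      · exact h3
    have hp (x : P.V) (hx : x ≠ P.rt) : r.par x ≠ x := r.par_ne hx
    have hx := h.ne x
    have hy := h.ne y
    rw [h.j_eq_iff (hj x), h.j_eq_iff (hj y), h.adj, ← h.injective.ne_iff, ← h.injective.ne_iff,
      h.rt, r.adj, Sym2.eq_iff]
    generalize i x = x at *
    generalize i y = y at *
    grind
  lt x hx := by
    have h1 := r.lt b hb
    rw [← h.injective.ne_iff, h.rt] at hx
    have h2 := r.lt _ hx
    split_ifs with h3
    · rw [h.ij]
      · rw [h3] at h2; rw [hba] at h1; omega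
      · exact fun e => r.par_ne hb (hba.trans e)
    · rwa [h.ij _ h3]

/-- Since `b` is white with the single branch `c`, the two edges contribute `z_m x^n = z_{m+n}` or
`x^m x^n = x^{m+n}`. The first identity fails for `m = 0`, as `z_0` is read as `y`; hence the
positivity of the upper index. -/
lemma isEval (hb : b ≠ P.rt) (hbc : r.kids b = {c}) (hba : r.par b = a)
    (hblack : b ∉ P.black) (hpos : 0 < P.k s(b, c)) {F : P.V → HAlg}
    (hF : r.IsEval P.plainFactor F) :
    (h.rooting r hb hbc hba).IsEval Q.plainFactor fun x => F (i x) := by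
  classical
  have hk (z : P.V) : z ≠ P.rt ∧ r.par z = b ↔ z = c := by
    rw [← Rooting.mem_kids, hbc, mem_singleton]
  have hc := (hk c).2 rfl
  have h1 := r.lt b hb
  have h2 := r.lt c hc.1
  rw [hba] at h1
  rw [hc.2] at h2
  have hab : a ≠ b := fun e => r.par_ne hb (hba.trans e)
  have hj (x) : (if r.par (i x) = b then a else r.par (i x)) ≠ b := by
    split_ifs with h3
    · exact hab
    · exact h3
  have hpar (x) (y) : (h.rooting r hb hbc hba).par x = y ↔
      (if r.par (i x) = b then a else r.par (i x)) = i y := by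
    rw [← h.j_eq_iff (hj x)]
    rfl
  have hkids (x : Q.V) (y : P.V) : y ∈ ((h.rooting r hb hbc hba).kids x).image i ↔
      y ≠ P.rt ∧ y ≠ b ∧ (if r.par y = b then a else r.par y) = i x := by
    simp only [mem_image, Rooting.mem_kids, hpar, ← h.injective.ne_iff, h.rt]
    constructor
    · rintro ⟨z, ⟨h3, h4⟩, rfl⟩
      exact ⟨h3, h.ne z, h4⟩
    · rintro ⟨h3, h4, h5⟩
      exact ⟨j y, by rw [h.ij y h4]; exact ⟨h3, h5⟩, h.ij y h4⟩
  have hmap (x : Q.V) (g : P.V → HAlg) :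
      shuffleProd ((h.rooting r hb hbc hba).kids x) (fun y => g (i y)) =
      shuffleProd (((h.rooting r hb hbc hba).kids x).image i) g :=
    (shuffleProd_image _ h.injective g).symm
  have hfac (x p : Q.V) (e : s(i p, i x) ≠ s(a, c)) :
      Q.plainFactor x p = P.plainFactor (i x) (i p) := by
    simp only [plainFactor, h.black, h.k p x e]
  intro x
  dsimp only
  by_cases hx : i x = a
  · have hbk : b ∈ r.kids a := Rooting.mem_kids.2 ⟨hb, hba⟩
    -- Among the children of `a`, the vertex `b` is replaced by `c`.
    have hkid : ((h.rooting r hb hbc hba).kids x).image i = insert c ((r.kids a).erase b) := by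
      ext y
      rw [hkids, mem_insert, mem_erase, Rooting.mem_kids]
      have := r.par_ne (x := y)
      grind
    have hcn : c ∉ (r.kids a).erase b := by
      intro h
      have := (Rooting.mem_kids.1 (mem_of_mem_erase h)).2
      rw [hc.2] at this
      rw [this] at h1
      omega
    have hcfac : F c * Q.plainFactor (j c) x = F b * P.plainFactor b a := by
      have hcb : c ≠ b := fun e => by rw [e] at h2; omega
      rw [hF b, hbc, shuffleProd_singleton]
      have hkk : Q.k s(x, j c) = P.k s(a, b) + P.k s(b, c) :=
        h.k_ac x (j c) (by rw [hx, h.ij c hcb])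
      simp only [plainFactor, h.black, hkk, hblack, if_false, h.ij c hcb]
      split_ifs
      · rw [mul_assoc, zGen, zGen, mul_assoc, ← pow_add]
        congr 3
        omega
      · rw [mul_assoc, ← pow_add, add_comm]
    calc F (i x) = shuffleProd (r.kids a) fun y => F y * P.plainFactor y a := by rw [hx, ← hF a]
      _ = shuffle (F b * P.plainFactor b a) (shuffleProd ((r.kids a).erase b)
          fun y => F y * P.plainFactor y a) :=
        (shuffle_shuffleProd_erase hbk fun y => F y * P.plainFactor y a).symm
      _ = shuffleProd (insert c ((r.kids a).erase b)) fun y => F y * Q.plainFactor (j y) x := by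
        rw [shuffleProd_insert hcn, hcfac]
        congr 1
        refine shuffleProd_congr rfl fun y hy => ?_
        have hyb := ne_of_mem_erase hy
        have hyc : y ≠ c := fun e => hcn (e ▸ hy)
        rw [hfac, h.ij y hyb, hx]
        rw [h.ij y hyb, hx]
        exact fun e => hyc (Sym2.congr_right.1 e)
      _ = _ := by
        rw [← hkid, ← hmap]
        exact shuffleProd_congr rfl fun y hy => by rw [h.ji]
  · have hkid : ((h.rooting r hb hbc hba).kids x).image i = r.kids (i x) := by
      ext y
      rw [hkids, Rooting.mem_kids]
      have := h.ne x
      grind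
    rw [hF (i x), ← hkid, ← hmap]
    refine shuffleProd_congr rfl fun y hy => ?_
    rw [hfac]
    intro e
    rcases Sym2.eq_iff.1 e with ⟨h4, _⟩ | ⟨h4, h5⟩
    · exact hx h4
    · have h6 := (hkids x (i y)).1 (mem_image_of_mem i hy)
      have := r.lt (i y) h6.1
      grind

end IsJoin


/-! ### Contraction of edges of index zero -/

open Classical in
/-- The factor of an edge from `c` to its parent `p` for an arbitrary coloring, where edges of index
zero are ignored. -/
def colFactor (P : Pair.{u}) (col : P.V → Prop) (c p : P.V) : HAlg :=
  if P.k s(p, c) = 0 then 1 else if col c then zGen (P.k s(p, c)) else genX ^ P.k s(p, c)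

/-- The vertex of highest level in a triangle would have two parents. -/
lemma Rooting.no_triangle {P : Pair.{u}} (r : P.Rooting) {x y z : P.V} (h1 : P.G.Adj x y)
    (h2 : P.G.Adj y z) (h3 : P.G.Adj x z) : False := by
  have h4 := h1.ne
  have h5 := h2.ne
  have h6 := h3.ne
  have hx := r.lt x
  have hy := r.lt y
  have hz := r.lt z
  rw [r.adj] at h1 h2 h3
  grind

/-- The graph of the edges of index zero. -/
def zeroGraph (P : Pair.{u}) : SimpleGraph P.V where
  Adj x y := P.G.Adj x y ∧ P.k s(x, y) = 0
  symm := ⟨fun x y h => ⟨h.1.symm, by rw [Sym2.eq_swap]; exact h.2⟩⟩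
  loopless := ⟨fun _ h => h.1.ne rfl⟩

/-- `Q` is, up to renaming, obtained from `P` by contraction of the edge `{a, b}` with a white end
`a`; the projection of the vertices is `j`. -/
structure IsContraction (P Q : Pair.{u}) (a b : P.V) (j : P.V → Q.V) : Prop where
  surj : Function.Surjective j
  eq_iff : ∀ x y, j x = j y ↔ x = y ∨ (x = a ∧ y = b) ∨ (x = b ∧ y = a)
  rt : Q.rt = j P.rt
  adj : ∀ p q, Q.G.Adj p q ↔ p ≠ q ∧ ∃ x y, j x = p ∧ j y = q ∧ P.G.Adj x y
  k : ∀ x y, P.G.Adj x y → j x ≠ j y → Q.k s(j x, j y) = P.k s(x, y)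
  black : ∀ x, x ≠ a → (j x ∈ Q.black ↔ x ∈ P.black)

lemma isContraction_contract (P : Pair.{u}) (r : P.Rooting) {a b : P.V} (ha : P.rt ≠ a)
    (hab : P.G.Adj a b) :
    P.IsContraction (P.contract a b ha) a b (retract a b hab.ne.symm) := by
  classical
  have hj (x : P.V) : (retract a b hab.ne.symm x).1 = if x = a then b else x := by
    unfold retract
    split_ifs <;> simp_all
  have hjs (x : {x : P.V // x ≠ a}) : retract a b hab.ne.symm x.1 = x := retract_val _ x
  have hjj (x y : P.V) : retract a b hab.ne.symm x = retract a b hab.ne.symm y ↔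
      x = y ∨ (x = a ∧ y = b) ∨ (x = b ∧ y = a) := by
    rw [Subtype.ext_iff, hj, hj]
    have := hab.ne
    grind
  refine ⟨fun x => ⟨x.1, hjs x⟩, hjj, ?_, ?_, ?_, ?_⟩
  · exact (hjs ⟨P.rt, ha⟩).symm
  · have key (p q : {x : P.V // x ≠ a}) : (p ≠ q ∧ (P.G.Adj p q ∨ (p.1 = b ∧ P.G.Adj a q) ∨
        (q.1 = b ∧ P.G.Adj a p))) ↔ p ≠ q ∧ ∃ x y, retract a b hab.ne.symm x = p ∧
          retract a b hab.ne.symm y = q ∧ P.G.Adj x y := by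
      refine and_congr_right fun hpq => ⟨?_, ?_⟩
      · rintro (h | ⟨h1, h2⟩ | ⟨h1, h2⟩)
        · exact ⟨p, q, hjs p, hjs q, h⟩
        · exact ⟨a, q, Subtype.ext (by rw [hj, if_pos rfl, h1]), hjs q, h2⟩
        · exact ⟨p, a, hjs p, Subtype.ext (by rw [hj, if_pos rfl, h1]), h2.symm⟩
      · rintro ⟨x, y, rfl, rfl, h⟩
        rw [hj, hj]
        by_cases hx : x = a
        · have hy : y ≠ a := fun hy => h.ne (hx.trans hy.symm)
          rw [if_pos hx, if_neg hy]
          exact Or.inr (Or.inl ⟨rfl, hx ▸ h⟩)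
        · by_cases hy : y = a
          · rw [if_pos hy, if_neg hx]
            exact Or.inr (Or.inr ⟨rfl, (hy ▸ h).symm⟩)
          · rw [if_neg hx, if_neg hy]
            exact Or.inl h
    exact key
  · intro x y h hne
    replace hne := fun e => hne ((hjj x y).2 e)
    have key (p q : {x : P.V // x ≠ a}) : (P.contract a b ha).k s(p, q) =
        if P.G.Adj p.1 q.1 then P.k s(p.1, q.1)
        else P.k s(if p.1 = b then a else p.1, if q.1 = b then a else q.1) := by
      simp only [contract]
      congr
    refine (key _ _).trans ?_
    rw [hj, hj]
    by_cases hx : x = a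
    · have hy : y ≠ a := fun hy => h.ne (hx.trans hy.symm)
      have hyb : y ≠ b := by grind
      rw [if_pos hx, if_neg hy, if_pos rfl, if_neg hyb, if_neg, hx]
      -- An edge between `b` and `y` would close a triangle with `a`, so the index in the contracted
      -- tree is read off from the edge at `a`.
      intro h'
      rw [hx] at h
      exact r.no_triangle hab h' h
    · by_cases hy : y = a
      · have hxb : x ≠ b := by grind
        rw [if_pos hy, if_neg hx, if_pos rfl, if_neg hxb, if_neg, hy]
        intro h'
        rw [hy] at h
        exact r.no_triangle hab h'.symm h.symm
      · rw [if_neg hx, if_neg hy, if_pos h]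
  · intro x hx
    classical
    have h : (retract a b hab.ne.symm x).1 = x := by rw [hj, if_neg hx]
    refine Iff.trans (Finset.mem_filter_univ _) ?_
    rw [h]

namespace IsContraction

variable {P Q : Pair.{u}} {a b : P.V} {j : P.V → Q.V}

/-- The merged vertex is represented by `top`, later taken to be the end nearer to the root. The
white end `a` may be either of the two. -/
lemma exists_section {top bot : P.V} (h : P.IsContraction Q a b j)
    (hab : (top = a ∧ bot = b) ∨ (top = b ∧ bot = a)) (hne : top ≠ bot) :
    ∃ t : Q.V → P.V, (∀ q, j (t q) = q) ∧ (∀ x, x ≠ bot → t (j x) = x) ∧ t (j bot) = top ∧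
      ∀ q, t q ≠ bot := by
  classical
  have htb : j bot = j top := by
    rw [h.eq_iff]
    grind
  have hex (q : Q.V) : ∃ x, j x = q ∧ x ≠ bot := by
    obtain ⟨x, rfl⟩ := h.surj q
    by_cases hx : x = bot
    · exact ⟨top, by rw [hx, htb], hne⟩
    · exact ⟨x, rfl, hx⟩
  choose t ht1 ht2 using hex
  refine ⟨t, ht1, fun x hx => ?_, ?_, ht2⟩
  · have h1 := (h.eq_iff _ _).1 (ht1 (j x))
    have := ht2 (j x)
    grind
  · have h1 := (h.eq_iff _ _).1 (ht1 (j bot))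
    have := ht2 (j bot)
    grind

/-- A contraction does not change the value of the tree. -/
lemma exists_isEval {top bot : P.V} (h : P.IsContraction Q a b j)
    (hab : (top = a ∧ bot = b) ∨ (top = b ∧ bot = a)) (r : P.Rooting) (hbot : bot ≠ P.rt)
    (hpar : r.par bot = top) (hk : P.k s(a, b) = 0) {col : P.V → Prop} {col' : Q.V → Prop}
    (hcol : ∀ x, col' (j x) ↔ col x) {F : P.V → HAlg} (hF : r.IsEval (P.colFactor col) F) :
    ∃ (r' : Q.Rooting) (F' : Q.V → HAlg), r'.IsEval (Q.colFactor col') F' ∧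
      F' Q.rt = F P.rt := by
  classical
  have hlt := r.lt bot hbot
  rw [hpar] at hlt
  have hne : top ≠ bot := fun e => by rw [e] at hlt; omega
  have hk' : P.k s(top, bot) = 0 := by
    rcases hab with ⟨rfl, rfl⟩ | ⟨rfl, rfl⟩
    · exact hk
    · rw [Sym2.eq_swap]; exact hk
  obtain ⟨t, ht1, ht2, ht3, ht4⟩ := h.exists_section hab hne
  have hj (x y) : j x = j y ↔ x = y ∨ (x = top ∧ y = bot) ∨ (x = bot ∧ y = top) := by
    rw [h.eq_iff]
    grind
  have htop : top ≠ P.rt → r.par top ≠ bot := fun h1 h2 => by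
    have := r.lt top h1
    rw [h2] at this
    omega
  have hrt (p) : p ≠ Q.rt ↔ t p ≠ P.rt := by
    obtain ⟨x, hx, rfl⟩ : ∃ x, x ≠ bot ∧ j x = p := ⟨t p, ht4 p, ht1 p⟩
    rw [ht2 x hx, h.rt, ne_eq, hj]
    grind
  let r' : Q.Rooting :=
    { par := fun q => j (r.par (t q))
      d := fun q => r.d (t q)
      adj := by
        intro p q
        have key (x y : P.V) (hx : x ≠ P.rt) (hxy : r.par x = y) (hpq : j x ≠ j y) :
            j x ≠ Q.rt ∧ j (r.par (t (j x))) = j y := by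
          have hxb : x ≠ bot := by
            rintro rfl
            exact hpq ((hj _ _).2 (Or.inr (Or.inr ⟨rfl, by rw [← hxy, hpar]⟩)))
          rw [hrt, ht2 x hxb, hxy]
          exact ⟨hx, rfl⟩
        have key' (p : Q.V) (hp : p ≠ Q.rt) : p ≠ j (r.par (t p)) ∧ P.G.Adj (t p) (r.par (t p)) := by
          rw [hrt] at hp
          refine ⟨?_, r.adj_par hp⟩
          intro e
          have h1 := (hj (t p) (r.par (t p))).1 (by rw [ht1, ← e])
          have h2 := r.par_ne hp
          have h3 := ht4 p
          grind
        rw [h.adj]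
        constructor
        · rintro ⟨hpq, x, y, rfl, rfl, hxy⟩
          rcases (r.adj x y).1 hxy with ⟨h1, h2⟩ | ⟨h1, h2⟩
          · exact Or.inl (key x y h1 h2 hpq)
          · exact Or.inr (key y x h1 h2 hpq.symm)
        · rintro (⟨h1, rfl⟩ | ⟨h1, rfl⟩)
          · exact ⟨(key' p h1).1, t p, _, ht1 p, rfl, (key' p h1).2⟩
          · exact ⟨(key' q h1).1.symm, _, t q, rfl, ht1 q, (key' q h1).2.symm⟩
      lt := by
        intro q hq
        rw [hrt] at hq
        have h1 := r.lt _ hq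
        by_cases h2 : r.par (t q) = bot
        · rw [h2, ht3]
          rw [h2] at h1
          omega
        · rw [ht2 _ h2]
          exact h1 }
  have hkids (q : Q.V) (y : P.V) : y ∈ (r'.kids q).image t ↔
      y ≠ bot ∧ y ≠ P.rt ∧ j (r.par y) = q := by
    simp only [mem_image, Rooting.mem_kids, hrt]
    constructor
    · rintro ⟨p, ⟨h1, h2⟩, rfl⟩
      exact ⟨ht4 p, h1, h2⟩
    · rintro ⟨h1, h2, h3⟩
      refine ⟨j y, ⟨by rwa [ht2 y h1], ?_⟩, ht2 y h1⟩
      change j (r.par (t (j y))) = q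
      rw [ht2 y h1, h3]
  have htinj : Function.Injective t := fun p q e => by rw [← ht1 p, e, ht1]
  have hfac (q : Q.V) (y : P.V) (h1 : y ≠ bot) (h2 : y ≠ P.rt) (h3 : j (r.par y) = q) :
      Q.colFactor col' (j y) q = P.colFactor col y (r.par y) := by
    have h4 : j (r.par y) ≠ j y := by
      rw [ne_eq, hj]
      have := r.par_ne h2
      grind
    subst h3
    simp only [colFactor, hcol, h.k _ _ (r.adj_par h2).symm h4]
  refine ⟨r', fun q => F (t q), fun q => ?_, ?_⟩
  · dsimp only
    have hmap : shuffleProd (r'.kids q) (fun p => F (t p) * Q.colFactor col' p q) =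
        shuffleProd ((r'.kids q).image t) (fun y => F y * P.colFactor col y (r.par y)) := by
      rw [shuffleProd_image _ htinj]
      refine shuffleProd_congr rfl fun p hp => ?_
      obtain ⟨h1, h2⟩ := Rooting.mem_kids.1 hp
      rw [← hfac q (t p) (ht4 p) ((hrt p).1 h1) h2, ht1]
    rw [hmap]
    by_cases hq : q = j bot
    -- At the merged vertex the branch `F bot`, which carries the factor `1`, dissolves into the
    -- branches at `bot`; associativity of the shuffle product merges them with those at `top`.
    · have hset : (r'.kids q).image t = (r.kids top).erase bot ∪ r.kids bot := by
        ext y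
        rw [hkids, mem_union, mem_erase, Rooting.mem_kids, Rooting.mem_kids, hq, hj]
        have := r.par_ne (x := y)
        grind
      have hbk : bot ∈ r.kids top := Rooting.mem_kids.2 ⟨hbot, hpar⟩
      have hdis : Disjoint ((r.kids top).erase bot) (r.kids bot) := by
        rw [Finset.disjoint_left]
        intro y h1 h2
        have h3 := (Rooting.mem_kids.1 (mem_of_mem_erase h1)).2
        rw [(Rooting.mem_kids.1 h2).2] at h3
        exact hne h3.symm
      have hcongr (s : P.V) : shuffleProd (r.kids s) (fun y => F y * P.colFactor col y (r.par y)) =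
          F s := by
        rw [hF s]
        exact shuffleProd_congr rfl fun y hy => by rw [(Rooting.mem_kids.1 hy).2]
      rw [hset, shuffleProd_union hdis, hcongr bot, hq, ht3, ← hcongr top,
        ← shuffle_shuffleProd_erase hbk, shuffle_comm, hpar]
      congr 1
      rw [colFactor, if_pos hk', mul_one]
    · have hset : (r'.kids q).image t = r.kids (t q) := by
        ext y
        rw [hkids, Rooting.mem_kids]
        have h1 : j (r.par y) = q ↔ r.par y = t q := by
          constructor
          · rintro rfl
            rw [ht2]
            intro e
            rw [e] at hq
            exact hq rfl
          · intro e; rw [e, ht1]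
        rw [h1]
        have : t q ≠ top := by
          intro e
          apply hq
          rw [← ht1 q, e, hj]
          exact Or.inr (Or.inl ⟨rfl, rfl⟩)
        grind
      rw [hset, hF (t q)]
      exact shuffleProd_congr rfl fun y hy => by rw [(Rooting.mem_kids.1 hy).2]
  · dsimp only
    rw [h.rt, ht2 _ hbot.symm]

/-- The contracted edge lies within one component and all other edges keep their index, so the
components of the two zero graphs correspond. -/
lemma reachable_iff (h : P.IsContraction Q a b j) (hab : P.zeroGraph.Adj a b) (x y : P.V) :
    Q.zeroGraph.Reachable (j x) (j y) ↔ P.zeroGraph.Reachable x y := by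
  have heq (x y : P.V) (e : j x = j y) : P.zeroGraph.Reachable x y := by
    rcases (h.eq_iff x y).1 e with rfl | ⟨rfl, rfl⟩ | ⟨rfl, rfl⟩
    · exact .rfl
    · exact hab.reachable
    · exact hab.symm.reachable
  constructor
  · rintro ⟨w⟩
    generalize hp : j x = p at w
    generalize hq : j y = q at w
    induction w generalizing x with
    | nil => exact heq x y (hp.trans hq.symm)
    | cons e w ih =>
      obtain ⟨hpq, x', y', h1, h2, h3⟩ := (h.adj _ _).1 e.1
      have h4 := e.2
      rw [← h1, ← h2] at h4 hpq
      rw [h.k x' y' h3 hpq] at h4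
      have h5 : P.zeroGraph.Adj x' y' := ⟨h3, h4⟩
      exact (heq x x' (hp.trans h1.symm)).trans (h5.reachable.trans (ih y' h2 hq))
  · rintro ⟨w⟩
    induction w with
    | nil => exact .rfl
    | @cons x x' _ e w ih =>
      refine SimpleGraph.Reachable.trans ?_ ih
      by_cases hx : j x = j x'
      · rw [hx]
      · refine SimpleGraph.Adj.reachable (G := Q.zeroGraph) ⟨?_, ?_⟩
        · exact (h.adj _ _).2 ⟨hx, x, x', rfl, rfl, e.1⟩
        · rw [h.k _ _ e.1 hx]; exact e.2

end IsContraction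

/-- The color of a vertex after contraction of all edges of index zero. -/
def col (P : Pair.{u}) (x : P.V) : Prop := ∃ v ∈ P.black, P.zeroGraph.Reachable x v

/-- The invariants of the contraction of edges. -/
structure ZeroInvariant (P : Pair.{u}) (a : HAlg) : Prop where
  root : P.rt ∈ P.black
  unique : ∀ v ∈ P.black, ∀ v' ∈ P.black, P.zeroGraph.Reachable v v' → v = v'
  eval : ∃ (r : P.Rooting) (F : P.V → HAlg), r.IsEval (P.colFactor P.col) F ∧ F P.rt = a

lemma ZeroInvariant.of_isContraction {P Q : Pair.{u}} {a : HAlg} (h : P.ZeroInvariant a)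
    {v v' : P.V} {j : P.V → Q.V} (hv : P.rt ≠ v) (hblack : v ∉ P.black) (hadj : P.G.Adj v v')
    (hk : P.k s(v, v') = 0) (hc : P.IsContraction Q v v' j) : Q.ZeroInvariant a := by
  obtain ⟨r, F, hF, hFa⟩ := h.eval
  have hz : P.zeroGraph.Adj v v' := ⟨hadj, hk⟩
  have hne (x) (hx : x ∈ P.black) : x ≠ v := fun e => hblack (e ▸ hx)
  have hb (q) (hq : q ∈ Q.black) : ∃ x ∈ P.black, j x = q := by
    obtain ⟨x, rfl⟩ := hc.surj q
    by_cases hx : x = v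
    · have e : j x = j v' := (hc.eq_iff _ _).2 (Or.inr (Or.inl ⟨hx, rfl⟩))
      rw [e] at hq ⊢
      exact ⟨v', (hc.black v' hadj.ne.symm).1 hq, rfl⟩
    · exact ⟨x, (hc.black x hx).1 hq, rfl⟩
  refine ⟨?_, ?_, ?_⟩
  · rw [hc.rt]
    exact (hc.black _ hv).2 h.root
  · intro p hp q hq hpq
    obtain ⟨x, hx, rfl⟩ := hb p hp
    obtain ⟨y, hy, rfl⟩ := hb q hq
    rw [h.unique x hx y hy ((hc.reachable_iff hz x y).1 hpq)]
  · have hcol (x) : Q.col (j x) ↔ P.col x := by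
      constructor
      · rintro ⟨q, hq, h1⟩
        obtain ⟨y, hy, rfl⟩ := hb q hq
        exact ⟨y, hy, (hc.reachable_iff hz x y).1 h1⟩
      · rintro ⟨y, hy, h1⟩
        exact ⟨j y, (hc.black y (hne y hy)).2 hy, (hc.reachable_iff hz x y).2 h1⟩
    rw [← hFa]
    rcases (r.adj v v').1 hadj with ⟨h1, h2⟩ | ⟨h1, h2⟩
    · exact hc.exists_isEval (Or.inr ⟨rfl, rfl⟩) r h1 h2 hk hcol hF
    · exact hc.exists_isEval (Or.inl ⟨rfl, rfl⟩) r h1 h2 hk hcol hF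

lemma ZeroInvariant.contracts {P Q : Pair.{u}} {a : HAlg} (h : P.ZeroInvariant a)
    (hPQ : P.Contracts Q) : Q.ZeroInvariant a := by
  obtain ⟨v, v', hv, hblack, hadj, hk, rfl⟩ := hPQ
  obtain ⟨r, -⟩ := h.eval
  exact h.of_isContraction hv hblack hadj hk (P.isContraction_contract r hv hadj)


/-! ### Exhausting a step -/

lemma exists_exhausts {R : Pair.{u} → Pair.{u} → Prop} (I : Pair.{u} → Prop) (μ : Pair.{u} → ℕ)
    (hI : ∀ P Q, I P → R P Q → I Q) (hμ : ∀ P Q, I P → R P Q → μ Q < μ P) {P : Pair.{u}}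
    (hP : I P) : ∃ Q, Exhausts R P Q := by
  induction hn : μ P using Nat.strong_induction_on generalizing P with
  | _ n ih =>
    by_cases h : ∃ Q, R P Q
    · obtain ⟨Q, hQ⟩ := h
      obtain ⟨Q', h1, h2⟩ := ih _ (hn ▸ hμ P Q hP hQ) (hI P Q hP hQ) rfl
      exact ⟨Q', .head hQ h1, h2⟩
    · exact ⟨P, .refl, fun Q' hQ' => h ⟨Q', hQ'⟩⟩

lemma Exhausts.invariant {R : Pair.{u} → Pair.{u} → Prop} {I : Pair.{u} → Prop}
    (hI : ∀ P Q, I P → R P Q → I Q) {P Q : Pair.{u}} (h : Exhausts R P Q) (hP : I P) : I Q := by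
  obtain ⟨h, -⟩ := h
  induction h with
  | refl => exact hP
  | tail _ h2 ih => exact hI _ _ ih h2

/-! ### Invariants of the harvesting procedure -/

/-- The invariants of the joining of edges. -/
structure PosInvariant (P : Pair.{u}) (a : HAlg) : Prop where
  root : P.rt ∈ P.black
  pos : ∀ x y, P.G.Adj x y → 0 < P.k s(x, y)
  eval : ∃ (r : P.Rooting) (F : P.V → HAlg), r.IsEval P.plainFactor F ∧ F P.rt = a

/-- The invariants of the insertion of vertices. -/
structure EvalInvariant (P : Pair.{u}) (a : HAlg) : Prop where
  root : P.rt ∈ P.black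
  eval : ∃ (r : P.Rooting) (F : P.V → HAlg), r.IsEval P.plainFactor F ∧ F P.rt = a

/-- A remaining edge of index zero would have two black ends in one component. So all indices are
positive, components are single vertices, and `colFactor` reduces to `plainFactor`. -/
lemma ZeroInvariant.posInvariant {P : Pair.{u}} {a : HAlg} (h : P.ZeroInvariant a)
    (hP : ∀ Q, ¬ P.Contracts Q) : P.PosInvariant a := by
  classical
  have hblack (x y) (hxy : P.G.Adj x y) (hk : P.k s(x, y) = 0) : x ∈ P.black := by
    by_contra hx
    exact hP _ ⟨x, y, fun e => hx (e ▸ h.root), hx, hxy, hk, rfl⟩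
  have hpos (x y) (hxy : P.G.Adj x y) : 0 < P.k s(x, y) := by
    rw [Nat.pos_iff_ne_zero]
    intro hk
    have hz : P.zeroGraph.Adj x y := ⟨hxy, hk⟩
    exact hxy.ne (h.unique x (hblack x y hxy hk) y
      (hblack y x hxy.symm (by rw [Sym2.eq_swap]; exact hk)) hz.reachable)
  refine ⟨h.root, hpos, ?_⟩
  obtain ⟨r, F, hF, hFa⟩ := h.eval
  refine ⟨r, F, fun v => ?_, hFa⟩
  have hcol (x) : P.col x ↔ x ∈ P.black := by
    constructor
    · rintro ⟨v, hv, ⟨w⟩⟩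
      cases w with
      | nil => exact hv
      | cons e _ => exact absurd e.2 (hpos _ _ e.1).ne'
    · exact fun hx => ⟨x, hx, .rfl⟩
  rw [hF v]
  refine shuffleProd_congr rfl fun c hc => ?_
  obtain ⟨hc1, rfl⟩ := Rooting.mem_kids.1 hc
  congr 1
  simp only [colFactor, plainFactor, (hpos _ _ (r.adj_par hc1).symm).ne', if_false]
  exact if_congr (hcol c) rfl rfl

lemma PosInvariant.of_isJoin {P Q : Pair.{u}} {a : HAlg} (h : P.PosInvariant a) (r : P.Rooting)
    {F : P.V → HAlg} (hF : r.IsEval P.plainFactor F) (hFa : F P.rt = a) {x b y : P.V}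
    {i : Q.V → P.V} {j : P.V → Q.V} (hQ : P.IsJoin Q x b y i j) (hb : b ≠ P.rt)
    (hblack : b ∉ P.black) (hx : r.par b = x) (hy : r.kids b = {y}) : Q.PosInvariant a := by
  have hby : P.G.Adj b y := by
    have := Rooting.mem_kids.1 (hy ▸ mem_singleton_self y)
    rw [← this.2]
    exact (r.adj_par this.1).symm
  refine ⟨?_, ?_, ?_⟩
  · rw [hQ.black, hQ.rt]
    exact h.root
  · intro p q hpq
    obtain ⟨h1, h2⟩ := (hQ.adj p q).1 hpq
    by_cases h3 : s(i p, i q) = s(x, y)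
    · rw [hQ.k_ac p q h3]
      have := h.pos b y hby
      omega
    · rw [hQ.k p q h3]
      exact h.pos _ _ (h2.resolve_right h3)
  · refine ⟨hQ.rooting r hb hy hx, fun q => F (i q),
      hQ.isEval r hb hy hx hblack (h.pos b y hby) hF, ?_⟩
    dsimp only
    rw [hQ.rt, hFa]

/-- One of the two neighbors of `b` is its parent and the other its only child. Either order can
occur, which is why the symmetry of `IsJoin` is needed. -/
lemma PosInvariant.joins {P Q : Pair.{u}} {a : HAlg} (h : P.PosInvariant a) (hPQ : P.Joins Q) :
    Q.PosInvariant a := by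
  obtain ⟨x, b, y, hb, hblack, hdeg, hxb, hby, hxy, rfl⟩ := hPQ
  obtain ⟨r, F, hF, hFa⟩ := h.eval
  have hj := P.isJoin_join x b y hb
  have hnb : P.G.neighborSet b = {x, y} := by
    refine (Set.eq_of_subset_of_ncard_le ?_ ?_ (Set.toFinite _)).symm
    · rintro z (rfl | rfl)
      · exact hxb.symm
      · exact hby
    · rw [Set.ncard_pair hxy]
      exact hdeg.le
  have hn (z) : P.G.Adj b z ↔ z = x ∨ z = y := by
    rw [← SimpleGraph.mem_neighborSet, hnb]
    simp
  have key (x y : P.V) (hxy : x ≠ y) (hn : ∀ z, P.G.Adj b z ↔ z = x ∨ z = y)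
      (hx : r.par b = x) : r.kids b = {y} := by
    ext z
    rw [Rooting.mem_kids, mem_singleton]
    constructor
    · rintro ⟨h1, h2⟩
      have h3 := (hn z).1 (by rw [← h2]; exact (r.adj_par h1).symm)
      refine h3.resolve_left ?_
      rintro rfl
      have := r.par_par_ne hb.symm (by rwa [hx])
      rw [hx, h2] at this
      exact this rfl
    · rintro rfl
      rcases (r.adj b z).1 ((hn z).2 (Or.inr rfl)) with ⟨_, h2⟩ | h2
      · exact absurd (hx.symm.trans h2) hxy
      · exact h2
  rcases (hn _).1 (r.adj_par hb.symm) with hx | hy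
  · exact h.of_isJoin r hF hFa hj hb.symm hblack hx (key x y hxy hn hx)
  · exact h.of_isJoin r hF hFa hj.symm hb.symm hblack hy
      (key y x hxy.symm (fun z => by rw [hn, or_comm]) hy)

lemma EvalInvariant.insertAt {P : Pair.{u}} {a : HAlg} (h : P.EvalInvariant a) (v : P.V) :
    (P.insertAt v).EvalInvariant a := by
  obtain ⟨r, F, hF, hFa⟩ := h.eval
  have hi := P.isInsertion_insertAt v
  refine ⟨?_, hi.rooting r, _, hi.isEval r hF, ?_⟩
  · rw [hi.rt, hi.black]
    exact h.root
  · rw [hi.rt, hi.ji, hFa]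

lemma EvalInvariant.w_eq {P : Pair.{u}} {a : HAlg} (h : P.EvalInvariant a) : P.w = a := by
  obtain ⟨r, F, hF, hFa⟩ := h.eval
  rw [r.w_eq hF, hFa]

/-! ### Termination of the harvesting procedure -/

open Classical in
/-- The number of black vertices with at least two children. -/
def branchCount (P : Pair.{u}) : ℕ := (P.black.filter fun x => 1 < (P.children x).card).card

/-- After the insertion `v` has a single child, and the vertex that inherits its branches is white
and not counted. -/
lemma IsInsertion.branchCount_lt {P Q : Pair.{u}} {v : P.V} {n : Q.V} {i : P.V → Q.V}
    {j : Q.V → P.V} (h : P.IsInsertion Q v n i j) (r : P.Rooting) (hv : v ∈ P.black)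
    (hc : 1 < (r.kids v).card) : Q.branchCount < P.branchCount := by
  classical
  unfold branchCount
  simp only [r.children_eq, (h.rooting r).children_eq]
  have hsub : (Q.black.filter fun x => 1 < ((h.rooting r).kids x).card) ⊆
      ((P.black.filter fun x => 1 < (r.kids x).card).erase v).image i := by
    intro q hq
    obtain ⟨h1, h2⟩ := mem_filter.1 hq
    rcases h.cases q with rfl | ⟨x, rfl⟩
    · exact absurd h1 h.black_n
    · have hx : x ≠ v := by
        rintro rfl
        rw [h.kids_i_self, card_singleton] at h2
        omega
      rw [h.kids_i r hx, card_image_of_injective _ h.injective] at h2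
      exact mem_image_of_mem _ (mem_erase.2 ⟨hx, mem_filter.2 ⟨(h.black x).1 h1, h2⟩⟩)
  refine (card_le_card hsub).trans_lt ?_
  rw [card_image_of_injective _ h.injective]
  exact card_erase_lt_of_mem (mem_filter.2 ⟨hv, hc⟩)

open Classical in
lemma deg_le {P : Pair.{u}} (r : P.Rooting) (v : P.V) :
    P.deg v ≤ (r.kids v).card + if v = P.rt then 0 else 1 := by
  classical
  have h : P.G.neighborSet v ⊆ ↑(r.kids v ∪ if v = P.rt then ∅ else {r.par v}) := by
    intro y hy
    rw [mem_coe, mem_union, Rooting.mem_kids]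
    rcases (r.adj v y).1 hy with ⟨h1, h2⟩ | h1
    · right; simp [h1, h2]
    · exact Or.inl h1
  refine (Set.ncard_le_ncard h (Set.toFinite _)).trans ?_
  rw [Set.ncard_coe_finset]
  refine (card_union_le _ _).trans ?_
  split_ifs <;> simp

lemma IsContraction.card_lt {P Q : Pair.{u}} {a b : P.V} {j : P.V → Q.V}
    (h : P.IsContraction Q a b j) (hab : a ≠ b) : Fintype.card Q.V < Fintype.card P.V :=
  Fintype.card_lt_of_surjective_not_injective j h.surj fun hi =>
    hab (hi ((h.eq_iff a b).2 (Or.inr (Or.inl ⟨rfl, rfl⟩))))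

lemma IsJoin.card_lt {P Q : Pair.{u}} {a b c : P.V} {i : Q.V → P.V} {j : P.V → Q.V}
    (h : P.IsJoin Q a b c i j) : Fintype.card Q.V < Fintype.card P.V :=
  Fintype.card_lt_of_injective_not_surjective i h.injective fun hi => by
    obtain ⟨q, hq⟩ := hi b
    exact h.ne q hq

lemma EvalInvariant.insertsAtBranch {P Q : Pair.{u}} {a : HAlg} (h : P.EvalInvariant a)
    (hPQ : P.InsertsAtBranch Q) : Q.EvalInvariant a := by
  obtain ⟨v, -, -, -, rfl⟩ := hPQ
  exact h.insertAt v

lemma EvalInvariant.insertsAtRoot {P Q : Pair.{u}} {a : HAlg} (h : P.EvalInvariant a)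
    (hPQ : P.InsertsAtRoot Q) : Q.EvalInvariant a := by
  obtain ⟨-, rfl⟩ := hPQ
  exact h.insertAt _

lemma PosInvariant.evalInvariant {P : Pair.{u}} {a : HAlg} (h : P.PosInvariant a) :
    P.EvalInvariant a := ⟨h.root, h.eval⟩

/-- The harvesting procedure terminates. -/
lemma exists_harvestableForm {P : Pair.{u}} {a : HAlg} (h : P.ZeroInvariant a) :
    ∃ Q, P.IsHarvestableForm Q := by
  obtain ⟨P₁, h₁⟩ := exists_exhausts (R := Contracts) (fun P => P.ZeroInvariant a)
    (fun P => Fintype.card P.V) (fun P Q hP hPQ => hP.contracts hPQ) (fun P Q hP hPQ => by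
      obtain ⟨v, v', hv, hblack, hadj, hk, rfl⟩ := hPQ
      obtain ⟨r, -⟩ := hP.eval
      exact (P.isContraction_contract r hv hadj).card_lt hadj.ne) h
  have I₁ := (h₁.invariant (I := fun P => P.ZeroInvariant a)
    (fun P Q hP hPQ => hP.contracts hPQ) h).posInvariant h₁.2
  obtain ⟨P₂, h₂⟩ := exists_exhausts (R := Joins) (fun P => P.PosInvariant a)
    (fun P => Fintype.card P.V) (fun P Q hP hPQ => hP.joins hPQ) (fun P Q hP hPQ => by
      obtain ⟨x, b, y, hb, -, -, -, -, -, rfl⟩ := hPQ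
      exact (P.isJoin_join x b y hb).card_lt) I₁
  have I₂ := (h₂.invariant (I := fun P => P.PosInvariant a)
    (fun P Q hP hPQ => hP.joins hPQ) I₁).evalInvariant
  obtain ⟨P₃, h₃⟩ := exists_exhausts (R := InsertsAtBranch) (fun P => P.EvalInvariant a)
    branchCount (fun P Q hP hPQ => hP.insertsAtBranch hPQ) (fun P Q hP hPQ => by
      obtain ⟨v, hv, hrt, hdeg, rfl⟩ := hPQ
      obtain ⟨r, -⟩ := hP.eval
      have := deg_le r v
      rw [if_neg hrt] at this
      exact (P.isInsertion_insertAt v).branchCount_lt r hv (by omega)) I₂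
  have I₃ := h₃.invariant (I := fun P => P.EvalInvariant a)
    (fun P Q hP hPQ => hP.insertsAtBranch hPQ) I₂
  obtain ⟨Q, h₄⟩ := exists_exhausts (R := InsertsAtRoot) (fun P => P.EvalInvariant a)
    branchCount (fun P Q hP hPQ => hP.insertsAtRoot hPQ) (fun P Q hP hPQ => by
      obtain ⟨hdeg, rfl⟩ := hPQ
      obtain ⟨r, -⟩ := hP.eval
      have := deg_le r P.rt
      rw [if_pos rfl] at this
      exact (P.isInsertion_insertAt P.rt).branchCount_lt r hP.root (by omega)) I₃
  exact ⟨Q, P₁, P₂, P₃, h₁, h₂, h₃, h₄⟩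

/-- The element `w` of a harvestable form can be computed on the original tree. -/
lemma w_harvestableForm {P Q : Pair.{u}} {a : HAlg} (h : P.ZeroInvariant a)
    (hQ : P.IsHarvestableForm Q) : Q.w = a := by
  obtain ⟨P₁, P₂, P₃, h₁, h₂, h₃, h₄⟩ := hQ
  have I₁ := (h₁.invariant (I := fun P => P.ZeroInvariant a)
    (fun P Q hP hPQ => hP.contracts hPQ) h).posInvariant h₁.2
  have I₂ := (h₂.invariant (I := fun P => P.PosInvariant a)
    (fun P Q hP hPQ => hP.joins hPQ) I₁).evalInvariant
  have I₃ := h₃.invariant (I := fun P => P.EvalInvariant a)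
    (fun P Q hP hPQ => hP.insertsAtBranch hPQ) I₂
  exact (h₄.invariant (I := fun P => P.EvalInvariant a)
    (fun P Q hP hPQ => hP.insertsAtRoot hPQ) I₃).w_eq

/-- On the generators of `2CRT`, the element `w` of a harvestable form is given by `colFactor`. -/
lemma IsTwoCRT.zeroInvariant {P : Pair.{u}} (hP : P.IsTwoCRT) (r : P.Rooting) {F : P.V → HAlg}
    (hF : r.IsEval (P.colFactor P.col) F) : P.ZeroInvariant (F P.rt) := by
  classical
  refine ⟨hP.root_mem, fun v hv v' hv' ⟨w⟩ => ?_, r, F, hF, rfl⟩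
  by_contra hne
  have hle : P.zeroGraph ≤ P.G := fun x y h => h.1
  have hpos := hP.essPos v hv v' hv' hne
  refine hpos.ne' (Finset.sum_eq_zero fun e he => ?_)
  obtain ⟨p, hp, hep⟩ := (mem_filter.1 he).2
  -- A walk along edges of index zero shortens to the unique path of the tree, whose index would
  -- then be zero.
  have h1 : (w.bypass.mapLe hle).IsPath := (SimpleGraph.Walk.isPath_mapLe hle).2 w.bypass_isPath
  have h2 := (hP.tree.isTree.existsUnique_path v v').unique hp h1
  rw [h2, SimpleGraph.Walk.edges_mapLe_eq_edges] at hep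
  have h3 := w.bypass.edges_subset_edgeSet hep
  induction e using Sym2.ind with
  | _ x y => exact h3.2

end Pair

/-! ### Edge factors and their generating series -/

lemma sum_piAntidiag_insert {ι M : Type*} [DecidableEq ι] [AddCommMonoid M] {s : Finset ι} {i : ι}
    (hi : i ∉ s) (n : ℕ) (f : (ι → ℕ) → M) :
    ∑ l ∈ piAntidiag (insert i s) n, f l =
      ∑ p ∈ antidiagonal n, ∑ l ∈ piAntidiag s p.1, f (Function.update l i p.2) := by
  have hu (l : ι → ℕ) (m : ℕ) : ∑ x ∈ s, Function.update l i m x = ∑ x ∈ s, l x :=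
    Finset.sum_congr rfl fun x hx =>
      Function.update_of_ne (ne_of_mem_of_not_mem hx hi) _ _
  rw [Finset.sum_sigma']
  refine Finset.sum_bij' (fun l _ => ⟨(∑ x ∈ s, l x, l i), Function.update l i 0⟩)
    (fun x _ => Function.update x.2 i x.1.2) ?_ ?_ ?_ ?_ ?_
  · intro l hl
    simp only [mem_piAntidiag, Finset.sum_insert hi] at hl
    simp only [mem_sigma, HasAntidiagonal.mem_antidiagonal, mem_piAntidiag, hu]
    refine ⟨by rw [← hl.1, add_comm], trivial, fun x hx => ?_⟩
    by_cases hxi : x = i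
    · subst hxi; simp at hx
    · rw [Function.update_of_ne hxi] at hx
      exact (mem_insert.1 (hl.2 x hx)).resolve_left hxi
  · rintro ⟨⟨p, q⟩, l⟩ hl
    simp only [mem_sigma, HasAntidiagonal.mem_antidiagonal, mem_piAntidiag] at hl
    simp only [mem_piAntidiag, Finset.sum_insert hi, Function.update_self, hu]
    refine ⟨by rw [hl.2.1, ← hl.1, add_comm], fun x hx => ?_⟩
    by_cases hxi : x = i
    · simp [hxi]
    · rw [Function.update_of_ne hxi] at hx
      exact mem_insert_of_mem (hl.2.2 x hx)
  · intro l hl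
    simp
  · rintro ⟨⟨p, q⟩, l⟩ hl
    simp only [mem_sigma, HasAntidiagonal.mem_antidiagonal, mem_piAntidiag] at hl
    have hli : l i = 0 := by
      by_contra h
      exact hi (hl.2.2 i h)
    simp only [Function.update_self, Function.update_idem, hu, hl.2.1]
    congr 1
    rw [← hli, Function.update_eq_self]
  · intro l hl
    simp

open Classical in
/-- The factor of an edge of index `n` below a vertex of color `c`. -/
def edgeFactor (n : ℕ) (c : Prop) : HAlg := if n = 0 then 1 else if c then zGen n else genX ^ n

open Classical in
/-- The letter of a color. -/
def colorLetter (c : Prop) : Fin 2 := if c then 1 else 0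

open Classical in
/-- The generating series of `edgeFactor`. -/
def edgeFactorSeries (n : ℕ) (c : Prop) : PowerSeries HAlg :=
  if n = 0 then 1 else edgeSeries n (colorLetter c)

/-- For `n = 0` the convention `binom(l - 1, l) = 0` for `l ≥ 1` leaves only the constant term `1`.
-/
lemma coeff_edgeFactorSeries (n : ℕ) (c : Prop) (l : ℕ) :
    PowerSeries.coeff l (edgeFactorSeries n c) =
      (((n + l - 1).choose l : ℕ) : ℚ) • edgeFactor (n + l) c := by
  classical
  by_cases hn : n = 0
  · subst hn
    cases l with
    | zero => simp [edgeFactorSeries, edgeFactor]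
    | succ l =>
      have : (0 + (l + 1) - 1).choose (l + 1) = 0 := Nat.choose_eq_zero_of_lt (by omega)
      rw [this]
      simp [edgeFactorSeries, PowerSeries.coeff_one]
  · rw [edgeFactorSeries, if_neg hn, edgeFactor, if_neg (by omega), edgeSeries,
      PowerSeries.coeff_mk, colorLetter]
    split_ifs
    · rfl
    · congr 1
      change genX * _ = _
      rw [← pow_succ']
      congr 1
      omega

namespace Pair

lemma colFactor_eq (P : Pair.{u}) (col : P.V → Prop) (c p : P.V) :
    P.colFactor col c p = edgeFactor (P.k s(p, c)) (col c) := rfl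

/-! ### Moving the root -/

/-- The same tree with another root and another index. -/
abbrev rerootAt (P : Pair.{u}) (v : P.V) (k : Sym2 P.V → ℕ) : Pair.{u} :=
  ⟨P.V, P.G, v, P.black, k⟩

namespace Rooting

variable {P : Pair.{u}} (r : P.Rooting)

/-- Recursion from the root to the leaves. -/
lemma exists_par_rec {A : Type*} (a₀ : A) (step : P.V → A → A) :
    ∃ f : P.V → A, f P.rt = a₀ ∧ ∀ v, v ≠ P.rt → f v = step v (f (r.par v)) := by
  classical
  let f : P.V → A := (measure r.d).wf.fix fun v ih =>
    if h : v = P.rt then a₀ else step v (ih (r.par v) (r.lt v h))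
  have hf (v) : f v = if h : v = P.rt then a₀ else step v (f (r.par v)) :=
    (measure r.d).wf.fix_eq _ v
  exact ⟨f, by rw [hf, dif_pos rfl], fun v hv => by rw [hf v, dif_neg hv]⟩

open Classical in
/-- The shuffle product of the branches at the siblings of a vertex. -/
def siblings (F : P.V → HAlg) (c : P.V) : HAlg :=
  shuffleProd ((r.kids (r.par c)).erase c) fun y => F y * P.colFactor P.col y (r.par c)

open Classical in
/-- Move the root of a tree to an adjacent vertex. -/
def moveRoot {v c : P.V} {k k' : Sym2 P.V → ℕ} (r : (P.rerootAt v k).Rooting)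
    (hcv : c ≠ v) (hc : r.par c = v) : (P.rerootAt c k').Rooting where
  par x := if x = v then c else r.par x
  -- The shift by one reserves level zero for the new root.
  d x := if x = c then 0 else r.d x + 1
  adj x y := by
    have h1 := r.adj x y
    dsimp only at *
    rw [h1]
    grind
  lt x hx := by
    have h1 := r.lt x
    dsimp only at *
    grind

/-- The element of the part of the tree on the other side of the edge from `v` to its parent. -/
def IsOut (F : P.V → HAlg) (out : (Sym2 P.V → ℕ) → P.V → HAlg) : Prop :=
  ∀ l, out l P.rt = 1 ∧ ∀ c, c ≠ P.rt → out l c = shuffle (r.siblings F c) (out l (r.par c)) *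
    edgeFactor (P.k s(c, r.par c) + l s(c, r.par c)) (P.col (r.par c))

lemma exists_isOut (F : P.V → HAlg) : ∃ out, r.IsOut F out := by
  choose f hf using fun l : Sym2 P.V → ℕ => r.exists_par_rec (1 : HAlg) fun c a =>
    shuffle (r.siblings F c) a *
      edgeFactor (P.k s(c, r.par c) + l s(c, r.par c)) (P.col (r.par c))
  exact ⟨f, hf⟩

variable {r} in
lemma IsOut.congr {F : P.V → HAlg} {out : (Sym2 P.V → ℕ) → P.V → HAlg} (h : r.IsOut F out)
    {l l' : Sym2 P.V → ℕ} {v : P.V} (hl : ∀ e ∈ P.path P.rt v, l e = l' e) :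
    out l v = out l' v := by
  induction v using r.par_induction with
  | root => rw [(h l).1, (h l').1]
  | step v hv ih =>
    rw [(h l).2 v hv, (h l').2 v hv, ih fun e he => hl e ((r.mem_path hv).2 (Or.inr he)),
      hl _ ((r.mem_path hv).2 (Or.inl rfl))]

/-- The data that describe the tree with root `v` and index `k + l`. -/
structure RerootData (F : P.V → HAlg) (o : HAlg) (l : Sym2 P.V → ℕ) (v : P.V) where
  rooting : (P.rerootAt v (P.k + l)).Rooting
  value : P.V → HAlg
  isEval : rooting.IsEval ((P.rerootAt v (P.k + l)).colFactor P.col) value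
  par_eq : ∀ y, r.d v < r.d y → rooting.par y = r.par y
  value_eq : ∀ y, r.d v < r.d y → value y = F y
  out_eq : v ≠ P.rt → value (r.par v) *
    edgeFactor ((P.k + l) s(v, r.par v)) (P.col (r.par v)) = o
  out_rt : v = P.rt → o = 1

namespace RerootData

variable {r} {F : P.V → HAlg} {o : HAlg} {l : Sym2 P.V → ℕ} {v : P.V}

open Classical in
lemma kids_eq (D : r.RerootData F o l v) :
    D.rooting.kids v = r.kids v ∪ if v = P.rt then ∅ else {r.par v} := by
  ext y
  have h1 := D.rooting.adj y v
  have h2 := r.adj y v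
  rw [mem_union, mem_kids, mem_kids]
  dsimp only at *
  have h3 : P.G.Adj y v ↔ y ≠ v ∧ D.rooting.par y = v := by rw [h1]; simp
  rw [← h3, h2]
  split_ifs with h4
  · simp [h4]
  · simp [h4, eq_comm]

/-- The edges from `v` to its old children lie off the path to the old root, so `l` vanishes there
and their branches are unchanged. The set `s` consists of all old children when the value at the new
root is computed, and omits one of them when the root moves on to it. -/
lemma shuffleProd_eq (D : r.RerootData F o l v) (hl : ∀ e, l e ≠ 0 → e ∈ P.path P.rt v)
    {s t : Finset P.V} (hs : s ⊆ r.kids v)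
    (ht : ∀ y, y ∈ t ↔ y ∈ s ∨ (v ≠ P.rt ∧ y = r.par v)) :
    shuffleProd t (fun y => D.value y * (P.rerootAt v (P.k + l)).colFactor P.col y v) =
      shuffle (shuffleProd s fun y => F y * P.colFactor P.col y v) o := by
  classical
  have h1 : shuffleProd s (fun y => D.value y *
      (P.rerootAt v (P.k + l)).colFactor P.col y v) =
      shuffleProd s fun y => F y * P.colFactor P.col y v := by
    refine shuffleProd_congr rfl fun y hy => ?_
    have hy' := mem_kids.1 (hs hy)
    have hd := lt_of_mem_kids (hs hy)
    have h0 : l s(v, y) = 0 := by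
      by_contra h
      have := r.d_le_of_mem_path (hl _ h) (Sym2.mem_mk_right v y)
      omega
    rw [D.value_eq y hd, colFactor_eq, colFactor_eq]
    change F y * edgeFactor (P.k s(v, y) + l s(v, y)) _ = _
    rw [h0, add_zero]
  by_cases hv : v = P.rt
  · have : t = s := by ext y; simp [ht, hv]
    rw [this, h1, D.out_rt hv, shuffle_one]
  · have hp : r.par v ∉ s := fun h => by
      have h1 := lt_of_mem_kids (hs h)
      have h2 := r.lt v hv
      omega
    have : t = insert (r.par v) s := by ext y; simp [ht, hv, or_comm]
    rw [this, shuffleProd_insert hp, h1, shuffle_comm, colFactor_eq]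
    exact congrArg _ (D.out_eq hv)

/-- The value of the tree at the new root. -/
lemma value_root (hF : r.IsEval (P.colFactor P.col) F) (D : r.RerootData F o l v)
    (hl : ∀ e, l e ≠ 0 → e ∈ P.path P.rt v) : D.value v = shuffle (F v) o := by
  classical
  rw [D.isEval v, hF v]
  refine D.shuffleProd_eq hl (Subset.refl _) fun y => ?_
  rw [D.kids_eq, mem_union]
  split_ifs with h <;> simp [h]

open Classical in
/-- Moving the root to a child. -/
lemma step {c : P.V} (hc : c ≠ P.rt)
    (D : r.RerootData F o (Function.update l s(c, r.par c) 0) (r.par c))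
    (hl : ∀ e, l e ≠ 0 → e ∈ P.path P.rt c) :
    Nonempty (r.RerootData F (shuffle (r.siblings F c) o *
      edgeFactor (P.k s(c, r.par c) + l s(c, r.par c)) (P.col (r.par c))) l c) := by
  generalize hv : r.par c = v at D
  generalize hl' : Function.update l s(c, v) 0 = l' at D
  have hdv : r.d v < r.d c := hv ▸ r.lt c hc
  have hcv : c ≠ v := fun h => by rw [h] at hdv; exact lt_irrefl _ hdv
  have hDc : D.rooting.par c = v := (D.par_eq c hdv).trans hv
  have hl0 : ∀ e, l' e ≠ 0 → e ∈ P.path P.rt v := fun e he => by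
    have hne : e ≠ s(c, v) := by
      rintro rfl
      exact he (hl' ▸ Function.update_self _ _ _)
    rw [← hl', Function.update_of_ne hne] at he
    have := (r.mem_path hc).1 (hl e he)
    rw [hv] at this
    exact this.resolve_left hne
  have hfac : ∀ x y, s(x, y) ≠ s(c, v) → (P.rerootAt c (P.k + l)).colFactor P.col y x =
      (P.rerootAt v (P.k + l')).colFactor P.col y x := fun x y h => by
    rw [colFactor_eq, colFactor_eq]
    change edgeFactor (P.k s(x, y) + l s(x, y)) _ = edgeFactor (P.k s(x, y) + l' s(x, y)) _
    rw [← hl', Function.update_of_ne h]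
  let R : (P.rerootAt c (P.k + l)).Rooting := D.rooting.moveRoot hcv hDc
  -- This is the value at `v` without the branch at `c`. In the tree rooted at `c`, the vertex `v`
  -- becomes a child with this value; otherwise only the value at `c` changes.
  let U : HAlg := shuffleProd ((D.rooting.kids v).erase c) fun y =>
    D.value y * (P.rerootAt v (P.k + l')).colFactor P.col y v
  let value : P.V → HAlg := fun x => if x = v then U else if x = c then
    shuffle (D.value c) (U * edgeFactor (P.k s(c, v) + l s(c, v)) (P.col v)) else D.value x
  have hR : ∀ x y, y ∈ R.kids x ↔ y ≠ c ∧ (if y = v then c else D.rooting.par y) = x :=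
    fun x y => mem_kids
  have hD : ∀ x y, y ∈ D.rooting.kids x ↔ y ≠ v ∧ D.rooting.par y = x := fun x y => mem_kids
  have hval : ∀ y, y ≠ v → y ≠ c → value y = D.value y := fun y h1 h2 => by
    simp only [value, if_neg h1, if_neg h2]
  have hvalv : value v = U := if_pos rfl
  have hU : U = shuffle (r.siblings F c) o := by
    rw [siblings, hv]
    refine D.shuffleProd_eq hl0 (erase_subset _ _) fun y => ?_
    rw [D.kids_eq, mem_erase, mem_erase, mem_union]
    have : v ≠ P.rt → r.par v ≠ c := fun h e => by
      have := r.lt v h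
      rw [e] at this
      omega
    split_ifs with h
    · simp [h]
    · simp only [mem_singleton]
      grind
  have heval : R.IsEval ((P.rerootAt c (P.k + l)).colFactor P.col) value := by
    intro x
    by_cases hxv : x = v
    · rw [hxv, hvalv]
      refine shuffleProd_congr ?_ fun y hy => ?_
      · ext y
        rw [mem_erase, hD, hR]
        grind
      · rw [hR] at hy
        have hyv : y ≠ v := by grind
        rw [hval y hyv hy.1, hfac]
        simp only [ne_eq, Sym2.eq_iff]
        grind
    by_cases hxc : x = c
    · rw [hxc]
      have hk : R.kids c = insert v (D.rooting.kids c) := by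
        ext y
        rw [mem_insert, hD, hR]
        have : y ≠ v → D.rooting.par y ≠ y := fun h => D.rooting.par_ne h
        grind
      have hv' : v ∉ D.rooting.kids c := fun h => ((hD _ _).1 h).1 rfl
      have h1 : value c = shuffle (D.value c)
          (U * edgeFactor (P.k s(c, v) + l s(c, v)) (P.col v)) := by
        simp only [value, if_neg hcv, if_true]
      rw [hk, shuffleProd_insert hv', hvalv, h1, shuffle_comm, D.isEval c]
      refine congrArg _ (shuffleProd_congr rfl fun y hy => ?_)
      have hyc : y ≠ c := by
        rintro rfl
        exact D.rooting.par_ne ((hD _ _).1 hy).1 ((hD _ _).1 hy).2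
      rw [hD] at hy
      rw [hval y hy.1 hyc, hfac]
      simp only [ne_eq, Sym2.eq_iff]
      grind
    · rw [hval x hxv hxc, D.isEval x]
      refine shuffleProd_congr ?_ fun y hy => ?_
      · ext y
        rw [hD, hR]
        grind
      · rw [hR] at hy
        have hyv : y ≠ v := by grind
        rw [hval y hyv hy.1, hfac]
        simp only [ne_eq, Sym2.eq_iff]
        grind
  refine ⟨R, value, heval, fun y hy => ?_, fun y hy => ?_, fun _ => ?_, fun h => absurd h hc⟩
  · have hyv : y ≠ v := by rintro rfl; omega
    change (if y = v then c else D.rooting.par y) = _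
    rw [if_neg hyv, D.par_eq y (hdv.trans hy)]
  · have hyv : y ≠ v := by rintro rfl; omega
    have hyc : y ≠ c := by rintro rfl; omega
    rw [hval y hyv hyc, D.value_eq y (hdv.trans hy)]
  · rw [hv, hvalv, hU]
    rfl

end RerootData

/-- The root is moved along the path to `v`. Each step switches on the increment of the edge just
crossed. -/
lemma exists_rerootData {F : P.V → HAlg} (hF : r.IsEval (P.colFactor P.col) F)
    {out : (Sym2 P.V → ℕ) → P.V → HAlg} (ho : r.IsOut F out) (v : P.V) (l : Sym2 P.V → ℕ)
    (hl : ∀ e, l e ≠ 0 → e ∈ P.path P.rt v) : Nonempty (r.RerootData F (out l v) l v) := by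
  classical
  induction v using r.par_induction generalizing l with
  | root =>
    have h0 : l = 0 := by
      funext e
      by_contra h
      have := hl e h
      rw [path_root] at this
      simp at this
    subst h0
    refine ⟨⟨⟨r.par, r.d, r.adj, r.lt⟩, F, fun x => hF x, fun _ _ => rfl, fun _ _ => rfl,
      fun h => absurd rfl h, fun _ => (ho 0).1⟩⟩
  | step c hc ih =>
    obtain ⟨D⟩ := ih (Function.update l s(c, r.par c) 0) fun e he => by
      have hne : e ≠ s(c, r.par c) := by
        rintro rfl
        exact he (Function.update_self _ _ _)
      rw [Function.update_of_ne hne] at he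
      exact ((r.mem_path hc).1 (hl e he)).resolve_left hne
    have h1 : out (Function.update l s(c, r.par c) 0) (r.par c) = out l (r.par c) :=
      ho.congr fun e he => Function.update_of_ne
        (fun h => r.notMem_path_par hc (r.par c) (by rwa [h] at he)) _ _
    rw [h1] at D
    rw [(ho l).2 c hc]
    exact D.step hc hl

/-- The generating series of `IsOut`. -/
def IsOutSeries (F : P.V → HAlg) (f : P.V → PowerSeries HAlg) : Prop :=
  f P.rt = 1 ∧ ∀ c, c ≠ P.rt → f c = act (r.siblings F c) (f (r.par c)) *
    edgeFactorSeries (P.k s(c, r.par c)) (P.col (r.par c))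

lemma exists_isOutSeries (F : P.V → HAlg) : ∃ f, r.IsOutSeries F f :=
  r.exists_par_rec (1 : PowerSeries HAlg) fun c a => act (r.siblings F c) a *
    edgeFactorSeries (P.k s(c, r.par c)) (P.col (r.par c))

/-- The increments on the edges of the path are independent, so each edge enters through a
convolution with its own series. -/
lemma IsOutSeries.coeff_eq {r : P.Rooting} [DecidableEq (Sym2 P.V)] {F : P.V → HAlg}
    {f : P.V → PowerSeries HAlg} (hf : r.IsOutSeries F f)
    {out : (Sym2 P.V → ℕ) → P.V → HAlg} (ho : r.IsOut F out) (v : P.V) (n : ℕ) :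
    PowerSeries.coeff n (f v) = ∑ l ∈ piAntidiag (P.path P.rt v) n,
      ((∏ e ∈ P.path P.rt v, (P.k e + l e - 1).choose (l e) : ℕ) : ℚ) • out l v := by
  induction v using r.par_induction generalizing n with
  | root =>
    rw [hf.1, path_root, PowerSeries.coeff_one]
    by_cases hn : n = 0
    · subst hn
      simp [(ho 0).1]
    · rw [if_neg hn, piAntidiag_empty_of_ne_zero hn, sum_empty]
  | step c hc ih =>
    have hne := r.notMem_path_par hc (r.par c)
    rw [r.path_eq_insert hc, sum_piAntidiag_insert hne, hf.2 c hc, PowerSeries.coeff_mul]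
    refine sum_congr rfl fun p _ => ?_
    rw [coeff_act, ih, coeff_edgeFactorSeries, map_sum, Finset.sum_mul]
    refine sum_congr rfl fun l _ => ?_
    have h1 : ∀ e ∈ P.path P.rt (r.par c), Function.update l s(c, r.par c) p.2 e = l e :=
      fun e he => Function.update_of_ne (ne_of_mem_of_not_mem he hne) _ _
    have hch : ∀ e ∈ P.path P.rt (r.par c), (P.k e + Function.update l s(c, r.par c) p.2 e - 1).choose
        (Function.update l s(c, r.par c) p.2 e) = (P.k e + l e - 1).choose (l e) :=
      fun e he => by rw [h1 e he]
    rw [(ho _).2 c hc, ho.congr h1, prod_insert hne, Function.update_self,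
      prod_congr rfl hch, map_smul, smul_mul_smul_comm, Nat.cast_mul,
      mul_comm ((Nat.choose _ _ : ℕ) : ℚ)]

end Rooting

/-! ### The values of the rerooted trees -/

lemma IsTwoCRT.reroot {P : Pair.{u}} (hP : P.IsTwoCRT) {v : P.V} (hv : v ∈ P.black)
    (l : Sym2 P.V → ℕ) : (P.reroot v l).IsTwoCRT where
  tree := ⟨hP.tree.isTree, hP.tree.terminal_mem⟩
  root_mem := hv
  essPos x hx y hy hxy :=
    lt_of_lt_of_le (hP.essPos x hx y hy hxy) (Finset.sum_le_sum fun _ _ => Nat.le_add_right _ _)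

/-- An increment that vanishes where `k` does leaves the graph of edges of index zero unchanged. -/
lemma col_rerootAt {P : Pair.{u}} (v : P.V) {l : Sym2 P.V → ℕ} (hl : ∀ e, P.k e = 0 → l e = 0) :
    (P.rerootAt v (P.k + l)).col = P.col := by
  have : (P.rerootAt v (P.k + l)).zeroGraph = P.zeroGraph := by
    ext x y
    change P.G.Adj x y ∧ P.k s(x, y) + l s(x, y) = 0 ↔ P.G.Adj x y ∧ P.k s(x, y) = 0
    have := hl s(x, y)
    constructor <;> grind
  funext x
  change (∃ z ∈ P.black, (P.rerootAt v (P.k + l)).zeroGraph.Reachable x z) = _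
  rw [this]
  rfl

lemma IsTwoCRT.w_reroot {P : Pair.{u}} (hP : P.IsTwoCRT) (r : P.Rooting) {F : P.V → HAlg}
    (hF : r.IsEval (P.colFactor P.col) F) {out : (Sym2 P.V → ℕ) → P.V → HAlg}
    (ho : r.IsOut F out) {v : P.V} (hv : v ∈ P.black) {l : Sym2 P.V → ℕ}
    (hl : ∀ e, l e ≠ 0 → e ∈ P.path P.rt v) (hl0 : ∀ e, P.k e = 0 → l e = 0) {Q : Pair.{u}}
    (hQ : (P.reroot v l).IsHarvestableForm Q) : Q.w = shuffle (F v) (out l v) := by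
  obtain ⟨D⟩ := r.exists_rerootData hF ho v l hl
  have h1 : (P.rerootAt v (P.k + l)).ZeroInvariant (D.value v) := by
    refine IsTwoCRT.zeroInvariant (hP.reroot hv l) D.rooting (F := D.value) ?_
    have := D.isEval
    rw [← col_rerootAt v hl0] at this
    exact this
  rw [w_harvestableForm h1 hQ, D.value_root hF hl]

lemma IsTwoCRT.mk_termCoeff {P : Pair.{u}} (hP : P.IsTwoCRT) {r : P.Rooting} {F : P.V → HAlg}
    (hF : r.IsEval (P.colFactor P.col) F) {f : P.V → PowerSeries HAlg} (hf : r.IsOutSeries F f)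
    {h : Pair.{u} → Pair.{u}} (hh : ∀ Q : Pair.{u}, Q.IsTwoCRT → Q.IsHarvestableForm (h Q))
    {v : P.V} (hv : v ∈ P.black) : PowerSeries.mk (P.termCoeff h v) = act (F v) (f v) := by
  let : DecidableEq (Sym2 P.V) := Classical.decEq _
  obtain ⟨out, ho⟩ := r.exists_isOut F
  ext n
  rw [PowerSeries.coeff_mk, coeff_act, hf.coeff_eq ho, map_sum]
  refine sum_congr rfl fun l hl => ?_
  have hl' := (mem_piAntidiag.1 hl).2
  by_cases h0 : ∀ e, P.k e = 0 → l e = 0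
  · rw [hP.w_reroot r hF ho hv hl' h0 (hh _ (hP.reroot hv l)), map_smul]
  -- An increment on an edge of index zero could change the colors of components, but its
  -- coefficient contains `binom(l - 1, l) = 0`.
  · push Not at h0
    obtain ⟨e, he, hle⟩ := h0
    have : ∏ e ∈ P.path P.rt v, (P.k e + l e - 1).choose (l e) = 0 :=
      prod_eq_zero (hl' e hle) (Nat.choose_eq_zero_of_lt (by omega))
    rw [this]
    simp

end Pair

/-! ### The operator `deconc` on a tree -/

/-- Crossing an edge replaces the waiting letter, the color of the lower end `p`, by that of the
upper end `c`. An edge of index zero strips no letter, so there the colors must agree. -/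
lemma deconc_mul_edgeFactor (a : HAlg) (n : ℕ) {c p : Prop} [Decidable (0 < n ∧ c)]
    (h : n = 0 → (c ↔ p)) (g : PowerSeries HAlg) :
    deconc (a * edgeFactor n c) (colorLetter p) g =
      (-1 : ℚ) ^ n • (deconc a (colorLetter c) (g * edgeFactorSeries n p) +
        if 0 < n ∧ c then act a (g * edgeFactorSeries n p) else 0) := by
  by_cases hn : n = 0
  · subst hn
    simp [edgeFactor, edgeFactorSeries, propext (h rfl)]
  · rw [edgeFactor, if_neg hn, edgeFactorSeries, if_neg hn]
    by_cases hc : c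
    · rw [if_pos hc, deconc_mul_zGen a (by omega), if_pos ⟨by omega, hc⟩, colorLetter, colorLetter,
        if_pos hc, add_comm]
    · obtain ⟨m, rfl⟩ : ∃ m, n = m + 1 := ⟨n - 1, by omega⟩
      have h0 : colorLetter c = 0 := if_neg hc
      rw [if_neg hc, deconc_mul_genX_pow, if_neg (fun h => hc h.2), add_zero, h0]

lemma shuffleProd_mem_HOne {ι : Type*} {s : Finset ι} {f : ι → HAlg} (h : ∀ i ∈ s, f i ∈ HOne) :
    shuffleProd s f ∈ HOne := by
  classical
  induction s using Finset.induction_on with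
  | empty => exact one_mem_HOne
  | insert i s hi ih =>
    rw [shuffleProd_insert hi]
    exact shuffle_mem_HOne (h i (mem_insert_self i s))
      (ih fun j hj => h j (mem_insert_of_mem hj))

lemma shuffleProd_mem_HPlus {ι : Type*} {s : Finset ι} {f : ι → HAlg} (hs : s.Nonempty)
    (h : ∀ i ∈ s, f i ∈ HPlus) : shuffleProd s f ∈ HPlus := by
  classical
  obtain ⟨i, hi⟩ := hs
  rw [← shuffle_shuffleProd_erase hi]
  exact shuffle_mem_HPlus (h i hi)
    (shuffleProd_mem_HOne fun j hj => HPlus_le (h j (mem_of_mem_erase hj)))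

namespace Pair

variable {P : Pair.{u}}

lemma col_iff_of_adj {x y : P.V} (h : P.zeroGraph.Adj x y) : P.col x ↔ P.col y :=
  ⟨fun ⟨v, hv, hx⟩ => ⟨v, hv, h.symm.reachable.trans hx⟩,
    fun ⟨v, hv, hy⟩ => ⟨v, hv, h.reachable.trans hy⟩⟩

lemma Rooting.zeroGraph_adj_par (r : P.Rooting) {c : P.V} (hc : c ≠ P.rt)
    (h : P.k s(c, r.par c) = 0) : P.zeroGraph.Adj c (r.par c) := ⟨r.adj_par hc, h⟩

/-- A factor `x^k` may only follow an element of `y ℌ`. At a vertex whose component has no black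
vertex this is ensured by the existence of a child: terminals are black, so such a vertex has degree
at least two. -/
lemma IsTwoCRT.mem_HOne (hP : P.IsTwoCRT) {r : P.Rooting} {F : P.V → HAlg}
    (hF : r.IsEval (P.colFactor P.col) F) (v : P.V) : F v ∈ HOne ∧ (¬ P.col v → F v ∈ HPlus) := by
  classical
  induction v using r.kids_induction with
  | step v ih =>
    have hfac : ∀ c ∈ r.kids v, F c * P.colFactor P.col c v ∈ HOne ∧
        (¬ P.col v → F c * P.colFactor P.col c v ∈ HPlus) := fun c hc => by
      obtain ⟨h1, h2⟩ := ih c hc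
      obtain ⟨hc1, rfl⟩ := Rooting.mem_kids.1 hc
      rw [colFactor_eq, edgeFactor, Sym2.eq_swap]
      split_ifs with hk hcol
      · rw [mul_one]
        exact ⟨h1, fun h => h2 fun h' => h ((col_iff_of_adj (r.zeroGraph_adj_par hc1 hk)).1 h')⟩
      · exact ⟨HPlus_le (mul_zGen_mem_HPlus h1 _), fun _ => mul_zGen_mem_HPlus h1 _⟩
      · exact ⟨HPlus_le (mul_mem_HPlus (h2 hcol) _), fun _ => mul_mem_HPlus (h2 hcol) _⟩
    rw [hF v]
    refine ⟨shuffleProd_mem_HOne fun c hc => (hfac c hc).1, fun hv =>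
      shuffleProd_mem_HPlus ?_ fun c hc => (hfac c hc).2 hv⟩
    have hb : v ∉ P.black := fun h => hv ⟨v, h, .rfl⟩
    have hrt : v ≠ P.rt := fun h => hb (h ▸ hP.root_mem)
    have h1 : P.deg v ≠ 1 := fun h => hb (hP.tree.terminal_mem v h)
    have h2 : 0 < P.deg v := (Set.ncard_pos).2 ⟨_, r.adj_par hrt⟩
    have h3 := deg_le r v
    rw [if_neg hrt] at h3
    exact card_pos.1 (by omega)

/-! ### Telescoping over the vertices -/

/-- The sign of a vertex. -/
def sign (P : Pair.{u}) (v : P.V) : ℚ := (-1) ^ ∑ e ∈ P.path P.rt v, P.k e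

lemma sign_root : P.sign P.rt = 1 := by simp [sign, Rooting.path_root]

namespace Rooting

variable (r : P.Rooting)

lemma sign_eq {c : P.V} (hc : c ≠ P.rt) :
    P.sign c = P.sign (r.par c) * (-1) ^ P.k s(c, r.par c) := by
  classical
  rw [sign, r.path_eq_insert hc, sum_insert (r.notMem_path_par hc _), pow_add, mul_comm, sign]

variable {r} {F : P.V → HAlg} {f : P.V → PowerSeries HAlg}

lemma shuffle_siblings (hF : r.IsEval (P.colFactor P.col) F) {c : P.V} (hc : c ≠ P.rt) :
    shuffle (F c * P.colFactor P.col c (r.par c)) (r.siblings F c) = F (r.par c) := by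
  classical
  rw [hF (r.par c)]
  exact shuffle_shuffleProd_erase (mem_kids.2 ⟨hc, rfl⟩)
    fun y => F y * P.colFactor P.col y (r.par c)

/-- Moving the root across an edge of index zero only regroups the shuffle product. -/
lemma act_eq_of_zero (hF : r.IsEval (P.colFactor P.col) F) (hf : r.IsOutSeries F f) {c : P.V}
    (hc : c ≠ P.rt) (hk : P.k s(c, r.par c) = 0) :
    act (F c) (f c) = act (F (r.par c)) (f (r.par c)) := by
  rw [← shuffle_siblings hF hc, act_shuffle, hf.2 c hc, colFactor_eq,
    Sym2.eq_swap (a := r.par c), hk]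
  simp [edgeFactor, edgeFactorSeries]

-- In the derivation rule the branches at the siblings of `c` are shuffled into `f v`. Crossing the
-- edge to `c` appends its series, and the result is `f c`.
open Classical in
lemma deconc_eq_sum_kids (hF : r.IsEval (P.colFactor P.col) F) (hf : r.IsOutSeries F f)
    (v : P.V) : deconc (F v) (colorLetter (P.col v)) (f v) =
      ∑ c ∈ r.kids v, (-1 : ℚ) ^ P.k s(c, r.par c) •
        (deconc (F c) (colorLetter (P.col c)) (f c) +
          if 0 < P.k s(c, r.par c) ∧ P.col c then act (F c) (f c) else 0) := by
  conv_lhs => rw [hF v]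
  rw [deconc_shuffleProd]
  refine sum_congr rfl fun c hc => ?_
  obtain ⟨hc1, rfl⟩ := mem_kids.1 hc
  rw [colFactor_eq, Sym2.eq_swap, deconc_mul_edgeFactor _ _
    (fun h => col_iff_of_adj (r.zeroGraph_adj_par hc1 h)), hf.2 c hc1]
  rfl

-- Sum `deconc_eq_sum_kids` with signs over all vertices. Every vertex other than the root is a
-- child exactly once, so all `deconc` terms cancel except the one at the root.
open Classical in
lemma deconc_root (hF : r.IsEval (P.colFactor P.col) F) (hf : r.IsOutSeries F f) :
    deconc (F P.rt) (colorLetter (P.col P.rt)) (f P.rt) =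
      ∑ c ∈ univ.filter (· ≠ P.rt), P.sign c •
        if 0 < P.k s(c, r.par c) ∧ P.col c then act (F c) (f c) else 0 := by
  have h1 : ∑ v, P.sign v • deconc (F v) (colorLetter (P.col v)) (f v) =
      ∑ c ∈ univ.filter (· ≠ P.rt), P.sign c •
        (deconc (F c) (colorLetter (P.col c)) (f c) +
          if 0 < P.k s(c, r.par c) ∧ P.col c then act (F c) (f c) else 0) := by
    rw [← sum_fiberwise (univ.filter (· ≠ P.rt)) r.par]
    refine sum_congr rfl fun v _ => ?_
    rw [deconc_eq_sum_kids hF hf, smul_sum]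
    refine sum_congr (by ext; simp [kids]) fun c hc => ?_
    rw [mem_filter, mem_filter_univ] at hc
    obtain ⟨hc1, rfl⟩ := hc
    rw [smul_smul, r.sign_eq hc1]
  simp only [smul_add, sum_add_distrib] at h1
  rw [filter_ne', ← add_sum_erase _ _ (mem_univ P.rt), sign_root, one_smul] at h1
  rw [filter_ne']
  exact add_left_cancel ((add_comm _ _).trans h1)

/-- The vertex closest to the root in the component of a vertex in the graph of edges of index
zero. -/
lemma exists_top (r : P.Rooting) : ∃ top : P.V → P.V,
    (∀ v, top v = P.rt ∨ 0 < P.k s(top v, r.par (top v))) ∧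
    (∀ v, v = P.rt ∨ 0 < P.k s(v, r.par v) → top v = v) ∧
    ∀ v w, top v = top w ↔ P.zeroGraph.Reachable v w := by
  classical
  obtain ⟨top, h0, h1⟩ := r.exists_par_rec P.rt
    fun v a => if P.k s(v, r.par v) = 0 then a else v
  have hreach : ∀ v, P.zeroGraph.Reachable v (top v) := fun v => by
    induction v using r.par_induction with
    | root => rw [h0]
    | step c hc ih =>
      rw [h1 c hc]
      split_ifs with h
      · exact (r.zeroGraph_adj_par hc h).reachable.trans ih
      · rfl
  have hadj : ∀ v w, P.zeroGraph.Adj v w → top v = top w := fun v w h => by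
    obtain ⟨⟨h2, rfl⟩ | ⟨h2, rfl⟩, h3⟩ := (⟨(r.adj v w).1 h.1, h.2⟩ : _ ∧ _)
    · rw [h1 v h2, if_pos h3]
    · rw [h1 w h2, if_pos (Sym2.eq_swap ▸ h3)]
  refine ⟨top, fun v => ?_, fun v hv => ?_, fun v w => ⟨fun h => ?_, fun ⟨p⟩ => ?_⟩⟩
  · induction v using r.par_induction with
    | root => exact Or.inl h0
    | step c hc ih =>
      rw [h1 c hc]
      split_ifs with h
      · exact ih
      · exact Or.inr (Nat.pos_of_ne_zero h)
  · by_cases h : v = P.rt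
    · rw [h, h0]
    · rw [h1 v h, if_neg (hv.resolve_left h).ne']
  · exact (hreach v).trans (h ▸ (hreach w).symm)
  · induction p with
    | nil => rfl
    | cons h p ih => exact (hadj _ _ h).trans (ih ⟨p⟩)

end Rooting

/-- The value of `φ̂` at the element of a tree. -/
lemma IsTwoCRT.phiHatOnH1_eq_sum (hP : P.IsTwoCRT) {r : P.Rooting} {F : P.V → HAlg}
    (hF : r.IsEval (P.colFactor P.col) F) {f : P.V → PowerSeries HAlg}
    (hf : r.IsOutSeries F f) :
    phiHatOnH1 (F P.rt) = ∑ v ∈ P.black, P.sign v • act (F v) (f v) := by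
  classical
  have hrt : P.col P.rt := ⟨_, hP.root_mem, .rfl⟩
  obtain ⟨top, htop, htop', hreach⟩ := r.exists_top
  have hinv : ∀ v, P.sign (top v) • act (F (top v)) (f (top v)) = P.sign v • act (F v) (f v) := by
    intro v
    induction v using r.par_induction with
    | root => rw [htop' _ (Or.inl rfl)]
    | step c hc ih =>
      by_cases hk : P.k s(c, r.par c) = 0
      · rw [(hreach _ _).2 (r.zeroGraph_adj_par hc hk).reachable, ih,
          Rooting.act_eq_of_zero hF hf hc hk, r.sign_eq hc, hk, pow_zero, mul_one]
      · rw [htop' _ (Or.inr (Nat.pos_of_ne_zero hk))]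
  -- A black vertex is sent to the top of its component, where the signed term is the same by
  -- `hinv`. Uniqueness of the black vertex in a component gives injectivity, and the definition of
  -- `col` gives surjectivity.
  have h1 : ∑ v ∈ P.black, P.sign v • act (F v) (f v) =
      ∑ c ∈ univ.filter (fun c => (c = P.rt ∨ 0 < P.k s(c, r.par c)) ∧ P.col c),
        P.sign c • act (F c) (f c) := by
    refine sum_bij (fun v _ => top v) (fun v hv => ?_) (fun v hv w hw h => ?_) (fun c hc => ?_)
      fun v _ => (hinv v).symm
    · rw [mem_filter_univ]
      exact ⟨htop v, v, hv, (hreach _ _).1 (htop' _ (htop v))⟩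
    · exact (hP.zeroInvariant r hF).unique v hv w hw ((hreach _ _).1 h)
    · rw [mem_filter_univ] at hc
      obtain ⟨hc1, v, hv, hcv⟩ := hc
      exact ⟨v, hv, by rw [← (hreach _ _).2 hcv, htop' c hc1]⟩
  have h2 : univ.filter (fun c => (c = P.rt ∨ 0 < P.k s(c, r.par c)) ∧ P.col c) =
      insert P.rt ((univ.filter (· ≠ P.rt)).filter
        fun c => 0 < P.k s(c, r.par c) ∧ P.col c) := by
    ext c
    simp only [mem_insert, mem_filter, mem_univ, true_and]
    by_cases hc : c = P.rt
    · simp [hc, hrt]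
    · simp [hc]
  have h3 := Rooting.deconc_root hF hf
  rw [hf.1, colorLetter, if_pos hrt] at h3
  rw [phiHatOnH1_eq (hP.mem_HOne hF _).1, h3, h1, h2, sum_insert (by simp), sign_root, one_smul,
    hf.1, ← map_one (PowerSeries.C (R := HAlg)), act_C, shuffle_one]
  simp only [smul_ite, smul_zero, sum_filter]

end Pair

end TwoCRT

end

/-! ### Conclusion -/

open TwoCRT
theorem theorem1p2 (P : Pair.{u}) (hP : P.IsTwoCRT) :
    (∃ Q : Pair.{u}, P.IsHarvestableForm Q) ∧
    ∀ h : Pair.{u} → Pair.{u}, (∀ Q : Pair.{u}, Q.IsTwoCRT → Q.IsHarvestableForm (h Q)) →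
      (h P).w ∈ HOne ∧
      phiHat (PowerSeries.C (h P).w) =
        ∑ v ∈ P.black, (-1 : ℚ) ^ (∑ e ∈ P.path P.rt v, P.k e) •
          PowerSeries.mk (P.termCoeff h v) ∧
      phi (h P).w =
        ∑ v ∈ P.black, (-1 : ℚ) ^ (∑ e ∈ P.path P.rt v, P.k e) • (h (P.reroot v 0)).w := by
  obtain ⟨r⟩ := Pair.exists_rooting P hP.tree.isTree
  obtain ⟨F, hF⟩ := r.exists_isEval (P.colFactor P.col)
  obtain ⟨f, hf⟩ := r.exists_isOutSeries F
  have hz := hP.zeroInvariant r hF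
  refine ⟨Pair.exists_harvestableForm hz, fun h hh => ?_⟩
  have hw : (h P).w = F P.rt := Pair.w_harvestableForm hz (hh P hP)
  have hphi : phiHat (PowerSeries.C (h P).w) =
      ∑ v ∈ P.black, (-1 : ℚ) ^ (∑ e ∈ P.path P.rt v, P.k e) •
        PowerSeries.mk (P.termCoeff h v) := by
    rw [phiHat_C, hw, hP.phiHatOnH1_eq_sum hF hf]
    exact Finset.sum_congr rfl fun v hv => by rw [hP.mk_termCoeff hF hf hh hv]; rfl
  refine ⟨hw ▸ (hP.mem_HOne hF _).1, hphi, ?_⟩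
  rw [phi, hphi, ← PowerSeries.coeff_zero_eq_constantCoeff_apply, map_sum]
  refine Finset.sum_congr rfl fun v _ => ?_
  change (-1 : ℚ) ^ _ • PowerSeries.coeff 0 (PowerSeries.mk (P.termCoeff h v)) = _
  rw [PowerSeries.coeff_mk, Pair.termCoeff]
  -- For `n = 0` only `l = 0` occurs, and all its binomial coefficients are `1`.
  simp
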